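/- Let $(W_k)_{k\ge 0}$ be the random walk on $\mathbb{Z}^2$ started at the origin whose steps are $(1,0)$, $(0,1)$, $(0,-1)$, each with probability $1/3$; let $p_k(t,s)=\mathrm{P}(W_k=(t,s))$ and let $g_3(t,s,a)=\sum_{k\ge 0}a^k p_k(t,s)$, $a\in[0,1)$, be the corresponding lattice Green function. Let $0<\beta<1$, $\beta\ne 1/2$, $\phi_1>0$, and let $\phi$ be a bounded probability density on $[0,1)$ with $\phi(a)\sim\phi_1(1-a)^\beta$ as $a\nearrow 1$. Let $M$ be a centred Gaussian random measure on $\mathbb{Z}^2\times[0,1)$ (independently scattered, $M(B)\sim N(0,m(B))$ whenever $m(B)<\infty$) with variance measure $m=\sigma^2\,(\text{counting measure on }\mathbb{Z}^2)\otimes\phi(a)\,\mathrm{d}a$, and write $M_{u,v}(\mathrm{d}a)$ for its restriction to $\{(u,v)\}\times[0,1)$. Then the aggregated Gaussian 3N field $$\mathfrak{X}_3(t,s)=\sum_{(u,v)\in\mathbb{Z}^2}\int_{[0,1)}g_3(t-u,s-v,a)\,M_{u,v}(\mathrm{d}a),\qquad (t,s)\in\mathbb{Z}^2,$$ is well defined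 as an $L^2$ stochastic integral, and its covariance function $r_3(t,s)=\mathrm{E}\,\mathfrak{X}_3(t,s)\mathfrak{X}_3(0,0)$ satisfies, for every $(t,s)\in\mathbb{R}^2\setminus\{(0,0)\}$, $$\lim_{\lambda\to\infty}\lambda^{\beta+1/2}\,r_3([\lambda t],[\sqrt{\lambda}\,s])=\begin{cases}C_3\,|s|^{-2\beta-1}\,\gamma\!\left(\beta+\tfrac12,\ \dfrac{s^2}{4|t|}\right), & t\ne 0,\ s\ne 0,\\[2mm] C_3\,|s|^{-2\beta-1}\,\Gamma(\beta+\tfrac12), & t=0,\\[1mm] C_4\,|t|^{-\beta-1/2}, & s=0,\end{cases}$$ where $[x]$ is the integer part of $x$ (the largest integer not exceeding $x$), $\gamma(\alpha,x)=\int_0^x y^{\alpha-1}\mathrm{e}^{-y}\,\mathrm{d}y$ is the lower incomplete gamma function, $$C_3=\pi^{-1/2}\,2^{2\beta-1}\,3^{1-\beta}\,\sigma^2\,\phi_1\,\Gamma(\beta+1),\qquad C_4=4^{-1/2-\beta}\left(\tfrac12+\beta\right)^{-1}C_3 .$$ In particular, $r_3(t,0)\sim C_4|t|^{-\beta-1/2}$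 as $|t|\to\infty$, $t\in\mathbb{Z}$. -/

import Mathlib

open MeasureTheory ProbabilityTheory Filter Topology Asymptotics
open scoped ENNReal NNReal

noncomputable section

namespace Aggregated3N

/-- The one-step law of the 3N random walk on `ℤ²`: each of the three steps `(1,0)`, `(0,1)`,
`(0,-1)` has probability `1/3`. -/
def stepLaw : PMF (ℤ × ℤ) :=
  PMF.uniformOfFinset {(1, 0), (0, 1), (0, -1)} (Finset.insert_nonempty _ _)

/-- The law of the position `W_k` of the 3N random walk started at the origin. -/
def walkLaw : ℕ → PMF (ℤ × ℤ)
  | 0 => PMF.pure 0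
  | k + 1 => (walkLaw k).bind fun w => stepLaw.map fun e => w + e

/-- The `k`-step probability `p_k(x) = P(W_k = x | W_0 = 0)`. -/
def transProb (k : ℕ) (x : ℤ × ℤ) : ℝ := (walkLaw k x).toReal

/-- The lattice Green function `g₃(x, a) = ∑_{k ≥ 0} a^k p_k(x)`, for `a ∈ [0,1)`. -/
def green (x : ℤ × ℤ) (a : ℝ) : ℝ := ∑' k : ℕ, a ^ k * transProb k x

/-- The mixing distribution `Φ(da) = φ(a) da` on `[0,1)`, as a measure on `ℝ`. -/
def mixingMeasure (φ : ℝ → ℝ) : Measure ℝ :=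
  (volume.restrict (Set.Ico (0 : ℝ) 1)).withDensity fun a => ENNReal.ofReal (φ a)

/-- The variance measure `σ² · (counting measure ⊗ Φ)` on `ℤ² × [0,1)` of the random measure
`(M_{u,v}(da))`. -/
def controlMeasure (σ : ℝ) (φ : ℝ → ℝ) : Measure ((ℤ × ℤ) × ℝ) :=
  ENNReal.ofReal (σ ^ 2) • (Measure.count : Measure (ℤ × ℤ)).prod (mixingMeasure φ)

/-- `M` is a centred Gaussian random measure on `E` with variance measure `m`: an independently
scattered, almost surely `σ`-additive random set function on the measurable sets of finite
`m`-measure such that `M B` has law `N(0, m B)`.  (The series in `sigma_additive` is taken in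
the given order; it need not converge absolutely.) -/
structure IsGaussianRandomMeasure {E Ω : Type*} [MeasurableSpace E] [MeasurableSpace Ω]
    (P : Measure Ω) (m : Measure E) (M : Set E → Ω → ℝ) : Prop where
  law : ∀ B : Set E, MeasurableSet B → m B < ∞ → HasLaw (M B) (gaussianReal 0 (m B).toNNReal) P
  independently_scattered : ∀ (n : ℕ) (B : Fin n → Set E),
    (∀ i, MeasurableSet (B i)) → (∀ i, m (B i) < ∞) → (∀ i j, i ≠ j → Disjoint (B i) (B j)) →
    iIndepFun (fun i => M (B i)) P
  sigma_additive : ∀ B : ℕ → Set E,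
    (∀ i, MeasurableSet (B i)) → (∀ i j, i ≠ j → Disjoint (B i) (B j)) → m (⋃ i, B i) < ∞ →
    ∀ᵐ ω ∂P, Tendsto (fun n : ℕ => ∑ i ∈ Finset.range n, M (B i) ω) atTop (𝓝 (M (⋃ i, B i) ω))

/-- The integral `∑_c c · M(f = c)` of a simple function against a random measure.  (The value
`c = 0` contributes nothing.) -/
def simpleIntegral {E Ω : Type*} [MeasurableSpace E] (M : Set E → Ω → ℝ) (f : SimpleFunc E ℝ)
    (ω : Ω) : ℝ :=
  ∑ c ∈ f.range, c * M (f ⁻¹' {c}) ω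

/-- `X = ∫ f dM`: the square-integrable function `f` is the `L²(m)`-limit of simple functions
whose integrals converge to `X` in `L²(P)`. -/
def IsStochasticIntegral {E Ω : Type*} [MeasurableSpace E] [MeasurableSpace Ω]
    (P : Measure Ω) (m : Measure E) (M : Set E → Ω → ℝ) (f : E → ℝ) (X : Ω → ℝ) : Prop :=
  MemLp f 2 m ∧ MemLp X 2 P ∧
    ∃ F : ℕ → SimpleFunc E ℝ, (∀ n, MemLp (F n) 2 m) ∧
      Tendsto (fun n => eLpNorm (fun x => F n x - f x) 2 m) atTop (𝓝 0) ∧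
      Tendsto (fun n => eLpNorm (fun ω => simpleIntegral M (F n) ω - X ω) 2 P) atTop (𝓝 0)

/-- `X` is the aggregated Gaussian 3N field driven by `M`:
`X(t,s) = ∑_{(u,v) ∈ ℤ²} ∫_{[0,1)} g₃(t-u, s-v, a) M_{u,v}(da)`, the sum and the integral being
taken together as a stochastic integral over `ℤ² × [0,1)`. -/
def IsAggregatedField {Ω : Type*} [MeasurableSpace Ω] (P : Measure Ω) (σ : ℝ) (φ : ℝ → ℝ)
    (M : Set ((ℤ × ℤ) × ℝ) → Ω → ℝ) (X : ℤ × ℤ → Ω → ℝ) : Prop :=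
  ∀ x : ℤ × ℤ,
    IsStochasticIntegral P (controlMeasure σ φ) M (fun p => green (x - p.1) p.2) (X x)

/-- The covariance function `r₃(t,s) = E X(t,s) X(0,0)`. -/
def covFun {Ω : Type*} [MeasurableSpace Ω] (P : Measure Ω) (X : ℤ × ℤ → Ω → ℝ) (t s : ℤ) : ℝ :=
  ∫ ω, X (t, s) ω * X (0, 0) ω ∂P

/-- The lower incomplete gamma function `γ(a, x) = ∫₀ˣ y^(a-1) e^(-y) dy`. -/
def lowerGamma (a x : ℝ) : ℝ := ∫ y in (0 : ℝ)..x, y ^ (a - 1) * Real.exp (-y)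

/-- `C₃ = π^(-1/2) 2^(2β-1) 3^(1-β) σ² φ₁ Γ(β+1)`. -/
def constC3 (β φ₁ σ : ℝ) : ℝ :=
  Real.pi ^ (-(1 / 2) : ℝ) * 2 ^ (2 * β - 1) * 3 ^ (1 - β) * σ ^ 2 * φ₁ * Real.Gamma (β + 1)

/-- `C₄ = 4^(-1/2-β) (1/2+β)⁻¹ C₃`. -/
def constC4 (β φ₁ σ : ℝ) : ℝ :=
  4 ^ (-(1 / 2) - β) * (1 / 2 + β)⁻¹ * constC3 β φ₁ σ

end Aggregated3N

end

/-! The Itô isometry gives r₃(t,s) = σ² ∫ φ(a) K(t,s,a) da with K(x,a) = ∑_u g₃(x+u,a) g₃(u,a), so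
everything reduces to a closed form for K and its behaviour as a ↑ 1.

Closed form. The horizontal coordinate never decreases, so after a Fourier transform in the vertical
variable the Green equation is a first-order recursion in t ≥ 0. With v = 1 - (2a/3) cos y and q =
(a/3)/v, the transform of g₃ is q^t / v; this is `green_eq_specGreen`, by uniqueness of bounded
solutions of the resolvent equation. Expanding one factor of K over the walk gives a geometric
series, and the transform of K is q^|t| / (v² - (a/3)²) (`hasSum_autocorr`). Hence |K| ≤ 3/(1-a),
which is integrable against φ = O((1-a)^β) because β > 0; this yields existence of the field.

Scaling. Substitute a = 1 - δ/λ and y = x/√λ. Then l^β φ(1 - δ/l) tends to φ₁ δ^β, q^[λt] to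
exp(-|t|(3δ + x²)), and λ(v² - (a/3)²) to (2/3)(δ + x²/3). For t ≠ 0 the factor q^n supplies
exponential decay in δ and Gaussian decay in x, so dominated convergence applies, first in x
(`tendsto_scaled_covKernel`) and then in δ (`tendsto_mixture`). Writing the limiting quotient as an
integral over w > |t| of exp(-w(3δ + x²)), integrating out x (Gaussian) and δ (Gamma), and putting y
= s²/(4w) produces the incomplete gamma function; s = 0 leaves a pure power of w.

For t = 0 that decay is absent: bounding the cosine by 1 leaves order δ^(-1/2), not integrable
against δ^β at infinity. Instead 1/(v² - (a/3)²) splits into two Poisson kernels with explicit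
coefficients (`covKernel_zero_succ`). One survives scaling and gives exp(-|s|√(3δ)); the resulting
Γ(2β+1) becomes Γ(β+1)Γ(β+1/2) by duplication. -/

noncomputable section

namespace Aggregated3N

/-! ### Itô isometry and existence of the stochastic integral -/

section StochasticIntegral

variable {E Ω : Type*} [MeasurableSpace E] [MeasurableSpace Ω] {P : Measure Ω} {m : Measure E}
  {M : Set E → Ω → ℝ}

theorem inner_toLp_two {α : Type*} [MeasurableSpace α] {μ : Measure α} {f g : α → ℝ}
    (hf : MemLp f 2 μ) (hg : MemLp g 2 μ) :
    inner ℝ (hf.toLp f) (hg.toLp g) = ∫ x, f x * g x ∂μ := by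
  rw [L2.inner_def]
  apply integral_congr_ae
  filter_upwards [hf.coeFn_toLp, hg.coeFn_toLp] with x hx hy
  rw [hx, hy]
  simp [mul_comm]

theorem IsGaussianRandomMeasure.memLp (hM : IsGaussianRandomMeasure P m M) {B : Set E}
    (hB : MeasurableSet B) (hmB : m B < ∞) : MemLp (M B) 2 P := by
  have h := hM.law B hB hmB
  have h2 := memLp_id_gaussianReal' (μ := 0) (v := (m B).toNNReal) 2 (by simp)
  rw [← h.map_eq] at h2
  exact (memLp_map_measure_iff (by fun_prop) h.aemeasurable).1 h2

theorem IsGaussianRandomMeasure.integral_eq_zero (hM : IsGaussianRandomMeasure P m M) {B : Set E}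
    (hB : MeasurableSet B) (hmB : m B < ∞) : ∫ ω, M B ω ∂P = 0 := by
  rw [(hM.law B hB hmB).integral_eq, integral_id_gaussianReal]

theorem IsGaussianRandomMeasure.integral_sq [IsProbabilityMeasure P]
    (hM : IsGaussianRandomMeasure P m M) {B : Set E}
    (hB : MeasurableSet B) (hmB : m B < ∞) : ∫ ω, M B ω * M B ω ∂P = m.real B := by
  have h := (hM.law B hB hmB).variance_eq
  rw [variance_id_gaussianReal, variance_of_integral_eq_zero (hM.law B hB hmB).aemeasurable
    (hM.integral_eq_zero hB hmB)] at h
  simp_rw [← sq, Measure.real, ← ENNReal.coe_toNNReal_eq_toReal]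
  exact h

theorem IsGaussianRandomMeasure.integral_mul_of_disjoint [IsProbabilityMeasure P]
    (hM : IsGaussianRandomMeasure P m M) {A B : Set E} (hA : MeasurableSet A) (hmA : m A < ∞)
    (hB : MeasurableSet B) (hmB : m B < ∞) (hAB : Disjoint A B) :
    ∫ ω, M A ω * M B ω ∂P = 0 := by
  have h := hM.independently_scattered 2 ![A, B] (by simp [Fin.forall_fin_two, hA, hB])
    (by simp [Fin.forall_fin_two, hmA, hmB]) (by simp [Fin.forall_fin_two, hAB, hAB.symm])
  have h2 : IndepFun (M A) (M B) P := by
    simpa using h.indepFun (show (0 : Fin 2) ≠ 1 by decide)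
  rw [h2.integral_fun_mul_eq_mul_integral (hM.memLp hA hmA).1 (hM.memLp hB hmB).1,
    hM.integral_eq_zero hA hmA, zero_mul]

theorem IsGaussianRandomMeasure.empty_ae (hM : IsGaussianRandomMeasure P m M) :
    M ∅ =ᵐ[P] 0 := by
  have h := hM.law ∅ .empty (by simp)
  simp only [measure_empty, ENNReal.toNNReal_zero, gaussianReal_zero_var] at h
  exact h.ae_eq_of_dirac

/-- Finite additivity is σ-additivity for the sequence A, B, ∅, ∅, …, whose partial sums are almost
surely constant from index 2 on because M ∅ = 0 a.s. -/
theorem IsGaussianRandomMeasure.union_ae (hM : IsGaussianRandomMeasure P m M) {A B : Set E}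
    (hA : MeasurableSet A) (hB : MeasurableSet B) (hAB : Disjoint A B) (hm : m (A ∪ B) < ∞) :
    ∀ᵐ ω ∂P, M (A ∪ B) ω = M A ω + M B ω := by
  let S : ℕ → Set E := fun i => if i = 0 then A else if i = 1 then B else ∅
  have hU : ⋃ i, S i = A ∪ B := by
    ext x
    simp only [Set.mem_iUnion, Set.mem_union]
    constructor
    · rintro ⟨i, hi⟩
      by_cases h0 : i = 0
      · left; simpa [S, h0] using hi
      · by_cases h1 : i = 1
        · right; simpa [S, h1] using hi
        · simp [S, h0, h1] at hi
    · rintro (h | h)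
      · exact ⟨0, by simpa [S] using h⟩
      · exact ⟨1, by simpa [S] using h⟩
  have h := hM.sigma_additive S
    (fun i => by simp only [S]; split_ifs <;> simp [hA, hB])
    (fun i j hij => by
      simp only [S]
      split_ifs <;> first | omega | simp [hAB.symm]) (by rwa [hU])
  rw [hU] at h
  filter_upwards [h, hM.empty_ae] with ω hω h0
  refine tendsto_nhds_unique hω (tendsto_const_nhds.congr' ?_)
  filter_upwards [eventually_ge_atTop 2] with n hn
  obtain ⟨k, rfl⟩ := Nat.exists_eq_add_of_le hn
  rw [Finset.sum_range_add, Finset.sum_eq_zero (s := Finset.range k)]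
  · simp [Finset.sum_range_succ, S]
  · intro i _
    simpa [S, show 2 + i ≠ 1 by omega] using h0

/-- Cutting A and B along A ∩ B leaves three disjoint pieces; independence and zero mean kill every
cross term, and only the variance of M(A ∩ B) remains. -/
theorem IsGaussianRandomMeasure.integral_mul [IsProbabilityMeasure P]
    (hM : IsGaussianRandomMeasure P m M) {A B : Set E} (hA : MeasurableSet A) (hmA : m A < ∞)
    (hB : MeasurableSet B) (hmB : m B < ∞) :
    ∫ ω, M A ω * M B ω ∂P = m.real (A ∩ B) := by
  have mI := hA.inter hB
  have fI : m (A ∩ B) < ∞ := (measure_mono Set.inter_subset_left).trans_lt hmA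
  have mA := hA.diff hB
  have fA : m (A \ B) < ∞ := (measure_mono Set.sdiff_subset).trans_lt hmA
  have mB := hB.diff hA
  have fB : m (B \ A) < ∞ := (measure_mono Set.sdiff_subset).trans_lt hmB
  have d1 : Disjoint (A ∩ B) (A \ B) := by
    rw [Set.disjoint_left]; rintro x ⟨_, h⟩ ⟨_, h'⟩; exact h' h
  have d2 : Disjoint (A ∩ B) (B \ A) := by
    rw [Set.disjoint_left]; rintro x ⟨h, _⟩ ⟨_, h'⟩; exact h' h
  have d3 : Disjoint (A \ B) (B \ A) := by
    rw [Set.disjoint_left]; rintro x ⟨h, _⟩ ⟨_, h'⟩; exact h' h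
  have hA' := hM.union_ae mI mA d1 (by rwa [Set.inter_union_sdiff])
  have hB' := hM.union_ae mI mB d2 (by rwa [Set.inter_comm A B, Set.inter_union_sdiff])
  rw [Set.inter_union_sdiff] at hA'
  rw [show A ∩ B ∪ B \ A = B by rw [Set.inter_comm A B, Set.inter_union_sdiff]] at hB'
  have LI := hM.memLp mI fI
  have LA := hM.memLp mA fA
  have LB := hM.memLp mB fB
  have key : (fun ω => M A ω * M B ω) =ᵐ[P] fun ω =>
      (M (A ∩ B) ω * M (A ∩ B) ω + M (A ∩ B) ω * M (B \ A) ω) +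
      (M (A ∩ B) ω * M (A \ B) ω + M (A \ B) ω * M (B \ A) ω) := by
    filter_upwards [hA', hB'] with ω h1 h2
    rw [h1, h2]; ring
  have i1 : Integrable (fun ω => M (A ∩ B) ω * M (A ∩ B) ω) P := LI.integrable_mul LI
  have i2 : Integrable (fun ω => M (A ∩ B) ω * M (B \ A) ω) P := LI.integrable_mul LB
  have i3 : Integrable (fun ω => M (A ∩ B) ω * M (A \ B) ω) P := LI.integrable_mul LA
  have i4 : Integrable (fun ω => M (A \ B) ω * M (B \ A) ω) P := LA.integrable_mul LB
  rw [integral_congr_ae key, integral_add (by exact i1.add i2) (by exact i3.add i4),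
    integral_add i1 i2,
    integral_add i3 i4, hM.integral_sq mI fI, hM.integral_mul_of_disjoint mI fI mB fB d2,
    hM.integral_mul_of_disjoint mI fI mA fA d1, hM.integral_mul_of_disjoint mA fA mB fB d3]
  simp

theorem memLp_simpleIntegral (hM : IsGaussianRandomMeasure P m M) {F : SimpleFunc E ℝ}
    (hF : MemLp F 2 m) : MemLp (simpleIntegral M F) 2 P := by
  unfold simpleIntegral
  apply memLp_finsetSum
  intro c _
  -- The level set of 0 may have infinite measure, where nothing is known about M; its coefficient 0
  -- removes it.
  rcases eq_or_ne c 0 with rfl | hc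
  · simp
  · exact (hM.memLp (F.measurableSet_preimage _)
      (SimpleFunc.measure_preimage_lt_top_of_memLp (by simp) (by simp) F hF c hc)).const_mul c

theorem integral_simpleIntegral_mul [IsProbabilityMeasure P] (hM : IsGaussianRandomMeasure P m M)
    {F G : SimpleFunc E ℝ} (hF : MemLp F 2 m) (hG : MemLp G 2 m) :
    ∫ ω, simpleIntegral M F ω * simpleIntegral M G ω ∂P = ∫ x, F x * G x ∂m := by
  have fF : ∀ c, c ≠ 0 → m (F ⁻¹' {c}) < ∞ :=
    SimpleFunc.measure_preimage_lt_top_of_memLp (by simp) (by simp) F hF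
  have fG : ∀ c, c ≠ 0 → m (G ⁻¹' {c}) < ∞ :=
    SimpleFunc.measure_preimage_lt_top_of_memLp (by simp) (by simp) G hG
  have hI : ∀ c d, Integrable (fun ω => (c * M (F ⁻¹' {c}) ω) * (d * M (G ⁻¹' {d}) ω)) P := by
    intro c d
    rcases eq_or_ne c 0 with rfl | hc
    · simp
    rcases eq_or_ne d 0 with rfl | hd
    · simp
    exact ((hM.memLp (F.measurableSet_preimage _) (fF c hc)).const_mul c).integrable_mul
      ((hM.memLp (G.measurableSet_preimage _) (fG d hd)).const_mul d)
  have hJ : ∀ c d, Integrable (fun x => (F ⁻¹' {c} ∩ G ⁻¹' {d}).indicator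
      (fun _ => c * d) x) m := by
    intro c d
    rcases eq_or_ne c 0 with rfl | hc
    · simp
    exact (integrable_indicator_iff
      ((F.measurableSet_preimage _).inter (G.measurableSet_preimage _))).2
      (integrableOn_const ((measure_mono Set.inter_subset_left).trans_lt (fF c hc)).ne)
  have hFG : ∀ x, F x * G x = ∑ c ∈ F.range, ∑ d ∈ G.range,
      (F ⁻¹' {c} ∩ G ⁻¹' {d}).indicator (fun _ => c * d) x := by
    intro x
    rw [Finset.sum_eq_single (F x), Finset.sum_eq_single (G x)]
    · simp
    · intro d _ hd
      simp [Ne.symm hd]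
    · simp
    · intro c _ hc
      simp [Ne.symm hc]
    · simp
  simp_rw [simpleIntegral, Finset.sum_mul_sum, hFG]
  rw [integral_finsetSum _ fun c _ => integrable_finsetSum _ fun d _ => hI c d,
    integral_finsetSum _ fun c _ => integrable_finsetSum _ fun d _ => hJ c d]
  refine Finset.sum_congr rfl fun c _ => ?_
  rw [integral_finsetSum _ fun d _ => hI c d, integral_finsetSum _ fun d _ => hJ c d]
  refine Finset.sum_congr rfl fun d _ => ?_
  rcases eq_or_ne c 0 with rfl | hc
  · simp
  rcases eq_or_ne d 0 with rfl | hd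
  · simp
  rw [integral_indicator ((F.measurableSet_preimage _).inter (G.measurableSet_preimage _)),
    setIntegral_const]
  simp_rw [mul_mul_mul_comm c _ d]
  rw [integral_const_mul, hM.integral_mul (F.measurableSet_preimage _) (fF c hc)
    (G.measurableSet_preimage _) (fG d hd), smul_eq_mul, mul_comm]

/-- The Itô isometry for a pair of stochastic integrals. -/
theorem IsStochasticIntegral.integral_mul [IsProbabilityMeasure P]
    (hM : IsGaussianRandomMeasure P m M) {f g : E → ℝ} {X Y : Ω → ℝ}
    (hX : IsStochasticIntegral P m M f X) (hY : IsStochasticIntegral P m M g Y) :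
    ∫ ω, X ω * Y ω ∂P = ∫ x, f x * g x ∂m := by
  obtain ⟨hf, hX2, F, hF, hFf, hFX⟩ := hX
  obtain ⟨hg, hY2, G, hG, hGg, hGY⟩ := hY
  have hIF := fun n => memLp_simpleIntegral hM (hF n)
  have hIG := fun n => memLp_simpleIntegral hM (hG n)
  have t1 := (Lp.tendsto_Lp_iff_tendsto_eLpNorm'' (fun n => F n) hF f hf).2 hFf
  have t2 := (Lp.tendsto_Lp_iff_tendsto_eLpNorm'' (fun n => G n) hG g hg).2 hGg
  have t3 := (Lp.tendsto_Lp_iff_tendsto_eLpNorm'' (fun n => simpleIntegral M (F n)) hIF X hX2).2 hFX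
  have t4 := (Lp.tendsto_Lp_iff_tendsto_eLpNorm'' (fun n => simpleIntegral M (G n)) hIG Y hY2).2 hGY
  have l1 := t1.inner (𝕜 := ℝ) t2
  have l2 := t3.inner (𝕜 := ℝ) t4
  simp_rw [inner_toLp_two] at l1 l2
  refine tendsto_nhds_unique l2 (l1.congr fun n => ?_)
  rw [integral_simpleIntegral_mul hM (hF n) (hG n)]

/-- The isometry on simple functions carries a Cauchy sequence of approximants from L²(m) to L²(P),
and completeness gives the limit. -/
theorem exists_isStochasticIntegral [IsProbabilityMeasure P]
    (hM : IsGaussianRandomMeasure P m M) {f : E → ℝ} (hf : MemLp f 2 m) :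
    ∃ X, IsStochasticIntegral P m M f X := by
  have hex : ∀ n : ℕ, ∃ g : SimpleFunc E ℝ, eLpNorm (f - ⇑g) 2 m < ((n : ℝ≥0∞) + 1)⁻¹ ∧
      MemLp g 2 m := fun n => hf.exists_simpleFunc_eLpNorm_sub_lt (by simp) (by simp)
  choose F hF1 hF using hex
  have hFf : Tendsto (fun n => eLpNorm (fun x => F n x - f x) 2 m) atTop (𝓝 0) := by
    refine tendsto_of_tendsto_of_tendsto_of_le_of_le tendsto_const_nhds
      (ENNReal.tendsto_inv_nat_nhds_zero.comp (tendsto_add_atTop_nat 1)) (fun _ => zero_le)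
      fun n => ?_
    have h := (hF1 n).le
    rw [eLpNorm_sub_comm] at h
    simpa using! h
  have hIF := fun n => memLp_simpleIntegral hM (hF n)
  have t1 := (Lp.tendsto_Lp_iff_tendsto_eLpNorm'' (fun n => F n) hF f hf).2 hFf
  -- Expanding squared norms of differences into inner products uses only the isometry for products,
  -- so additivity of `simpleIntegral` is not needed.
  have hdist : ∀ i j, dist ((hIF i).toLp _) ((hIF j).toLp _) =
      dist ((hF i).toLp _) ((hF j).toLp _) := by
    intro i j
    rw [dist_eq_norm, dist_eq_norm, ← sq_eq_sq₀ (norm_nonneg _) (norm_nonneg _),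
      @norm_sub_sq_real, @norm_sub_sq_real, ← real_inner_self_eq_norm_sq,
      ← real_inner_self_eq_norm_sq, ← real_inner_self_eq_norm_sq, ← real_inner_self_eq_norm_sq]
    simp_rw [inner_toLp_two, integral_simpleIntegral_mul hM (hF _) (hF _)]
  have hC : CauchySeq fun n => (hIF n).toLp (simpleIntegral M (F n)) := by
    have := t1.cauchySeq
    rw [Metric.cauchySeq_iff] at this ⊢
    simpa only [hdist] using this
  obtain ⟨X, hX⟩ := cauchySeq_tendsto_of_complete hC
  refine ⟨X, hf, Lp.memLp X, F, hF, hFf, ?_⟩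
  refine (Lp.tendsto_Lp_iff_tendsto_eLpNorm'' (fun n => simpleIntegral M (F n)) hIF X
    (Lp.memLp X)).1 ?_
  rwa [Lp.toLp_coeFn]

end StochasticIntegral

/-! ### The walk, its Green function and the resolvent equation -/

section Walk

theorem stepLaw_apply_of_mem {e : ℤ × ℤ} (he : e ∈ ({(1, 0), (0, 1), (0, -1)} : Finset (ℤ × ℤ))) :
    stepLaw e = 3⁻¹ := by
  rw [stepLaw, PMF.uniformOfFinset_apply_of_mem _ he]
  simp

theorem walkLaw_succ_apply (k : ℕ) (x : ℤ × ℤ) :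
    walkLaw (k + 1) x = 3⁻¹ * walkLaw k (x - (1, 0)) + 3⁻¹ * walkLaw k (x - (0, 1)) +
      3⁻¹ * walkLaw k (x - (0, -1)) := by
  have h1 : walkLaw (k + 1) = stepLaw.bind fun e => (walkLaw k).bind fun w => PMF.pure (w + e) := by
    rw [PMF.bind_comm]; rfl
  have h2 : ∀ e, ((walkLaw k).bind fun w => PMF.pure (w + e)) x = walkLaw k (x - e) := by
    intro e
    rw [PMF.bind_apply, tsum_eq_single (x - e)]
    · simp
    · intro w hw
      rw [PMF.pure_apply, if_neg, mul_zero]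
      rintro rfl
      simp at hw
  rw [h1, PMF.bind_apply, tsum_eq_sum (s := {(1, 0), (0, 1), (0, -1)})]
  · simp_rw [h2]
    rw [Finset.sum_insert (by decide), Finset.sum_insert (by decide), Finset.sum_singleton,
      stepLaw_apply_of_mem (by decide), stepLaw_apply_of_mem (by decide),
      stepLaw_apply_of_mem (by decide), add_assoc]
  · intro e he
    rw [stepLaw, PMF.uniformOfFinset_apply_of_notMem _ he, zero_mul]

theorem transProb_zero (x : ℤ × ℤ) : transProb 0 x = if x = 0 then 1 else 0 := by
  rw [transProb, walkLaw, PMF.pure_apply]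
  split_ifs <;> simp_all

theorem transProb_succ (k : ℕ) (x : ℤ × ℤ) :
    transProb (k + 1) x = 3⁻¹ * (transProb k (x - (1, 0)) + transProb k (x - (0, 1)) +
      transProb k (x - (0, -1))) := by
  have h : ∀ y, (3⁻¹ : ℝ≥0∞) * walkLaw k y ≠ ∞ := fun y =>
    ENNReal.mul_ne_top (by simp) ((walkLaw k).apply_ne_top y)
  simp only [transProb]
  rw [walkLaw_succ_apply, ENNReal.toReal_add (ENNReal.add_ne_top.2 ⟨h _, h _⟩) (h _),
    ENNReal.toReal_add (h _) (h _)]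
  simp only [ENNReal.toReal_mul, ENNReal.toReal_inv, ENNReal.toReal_ofNat]
  ring

theorem transProb_nonneg (k : ℕ) (x : ℤ × ℤ) : 0 ≤ transProb k x := ENNReal.toReal_nonneg

theorem hasSum_transProb (k : ℕ) : HasSum (transProb k) 1 := by
  have h := ENNReal.hasSum_toReal (f := walkLaw k) (by rw [PMF.tsum_coe]; simp)
  rw [← ENNReal.tsum_toReal_eq (fun x => (walkLaw k).apply_ne_top x), PMF.tsum_coe] at h
  exact h

theorem transProb_le_one (k : ℕ) (x : ℤ × ℤ) : transProb k x ≤ 1 :=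
  ENNReal.toReal_le_of_le_ofReal zero_le_one (by simpa using (walkLaw k).coe_le_one x)

variable {a : ℝ}

theorem summable_green (ha : 0 ≤ a) (ha1 : a < 1) (x : ℤ × ℤ) :
    Summable fun k : ℕ => a ^ k * transProb k x :=
  (summable_geometric_of_lt_one ha ha1).of_nonneg_of_le
    (fun k => mul_nonneg (pow_nonneg ha k) (transProb_nonneg k x))
    fun k => mul_le_of_le_one_right (pow_nonneg ha k) (transProb_le_one k x)

theorem green_nonneg (ha : 0 ≤ a) (x : ℤ × ℤ) : 0 ≤ green x a :=
  tsum_nonneg fun k => mul_nonneg (pow_nonneg ha k) (transProb_nonneg k x)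

theorem green_le (ha : 0 ≤ a) (ha1 : a < 1) (x : ℤ × ℤ) : green x a ≤ (1 - a)⁻¹ := by
  rw [← tsum_geometric_of_lt_one ha ha1]
  exact (summable_green ha ha1 x).tsum_le_tsum
    (fun k => mul_le_of_le_one_right (pow_nonneg ha k) (transProb_le_one k x))
    (summable_geometric_of_lt_one ha ha1)

/-- The k = 0 term is the point mass, and each later term is conditioned on one step of the walk. -/
theorem green_eq (ha : 0 ≤ a) (ha1 : a < 1) (x : ℤ × ℤ) :
    green x a = (if x = 0 then 1 else 0) +
      a / 3 * (green (x - (1, 0)) a + green (x - (0, 1)) a + green (x - (0, -1)) a) := by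
  have h := fun y => summable_green ha ha1 y
  simp only [green]
  rw [(h x).tsum_eq_zero_add, ← (h _).tsum_add (h _), ← ((h _).add (h _)).tsum_add (h _),
    ← tsum_mul_left]
  congr 1
  · simp [transProb_zero]
  · refine tsum_congr fun k => ?_
    rw [transProb_succ, pow_succ]
    ring

/-- A bounded solution of the homogeneous resolvent equation vanishes. -/
theorem eq_zero_of_bounded_of_resolvent (ha : 0 ≤ a) (ha1 : a < 1) {d : ℤ × ℤ → ℝ} {C : ℝ}
    (hC : ∀ x, |d x| ≤ C)
    (hd : ∀ x, d x = a / 3 * (d (x - (1, 0)) + d (x - (0, 1)) + d (x - (0, -1)))) (x : ℤ × ℤ) :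
    d x = 0 := by
  -- The right-hand side of the equation shrinks the sup norm by the factor a, so it can be
  -- iterated.
  have h : ∀ k : ℕ, ∀ x, |d x| ≤ a ^ k * C := by
    intro k
    induction k with
    | zero => simpa using hC
    | succ k ih =>
      intro x
      rw [hd x, abs_mul, abs_of_nonneg (by positivity)]
      have h3 := abs_add_three (d (x - (1, 0))) (d (x - (0, 1))) (d (x - (0, -1)))
      calc a / 3 * |d (x - (1, 0)) + d (x - (0, 1)) + d (x - (0, -1))|
          ≤ a / 3 * (a ^ k * C + a ^ k * C + a ^ k * C) := by
            gcongr
            exact h3.trans (add_le_add (add_le_add (ih _) (ih _)) (ih _))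
        _ = a ^ (k + 1) * C := by ring
  have hlim : Tendsto (fun k : ℕ => a ^ k * C) atTop (𝓝 0) := by
    simpa using (tendsto_pow_atTop_nhds_zero_of_lt_one ha ha1).mul_const C
  exact abs_eq_zero.1 (le_antisymm (ge_of_tendsto' hlim fun k => h k x) (abs_nonneg _))

end Walk

/-! ### Cosine Fourier coefficients -/

section CosineCoefficient

/-- The cosine Fourier coefficient `(2π)⁻¹ ∫_{-π}^{π} cos(s y) h(y) dy`. -/
def cosCoeff (h : ℝ → ℝ) (s : ℤ) : ℝ :=
  (2 * Real.pi)⁻¹ * ∫ y in (-Real.pi)..Real.pi, Real.cos (s * y) * h y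

theorem cosCoeff_congr {h h' : ℝ → ℝ} (e : ∀ y, h y = h' y) (s : ℤ) :
    cosCoeff h s = cosCoeff h' s := by
  rw [funext e]

theorem cosCoeff_neg (h : ℝ → ℝ) (s : ℤ) : cosCoeff h (-s) = cosCoeff h s := by
  simp [cosCoeff]

theorem cosCoeff_add {h h' : ℝ → ℝ} (hh : Continuous h) (hh' : Continuous h') (s : ℤ) :
    cosCoeff (fun y => h y + h' y) s = cosCoeff h s + cosCoeff h' s := by
  simp only [cosCoeff, mul_add]
  rw [intervalIntegral.integral_add, mul_add] <;>
  exact Continuous.intervalIntegrable (by fun_prop) _ _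

theorem cosCoeff_const_mul (c : ℝ) (h : ℝ → ℝ) (s : ℤ) :
    cosCoeff (fun y => c * h y) s = c * cosCoeff h s := by
  simp only [cosCoeff, mul_left_comm _ c]
  rw [intervalIntegral.integral_const_mul]
  ring

/-- This turns the pair of vertical steps into multiplication by 2 cos y. -/
theorem cosCoeff_shift {h : ℝ → ℝ} (hh : Continuous h) (s : ℤ) :
    cosCoeff h (s - 1) + cosCoeff h (s + 1) = cosCoeff (fun y => 2 * Real.cos y * h y) s := by
  simp only [cosCoeff]
  rw [← mul_add, ← intervalIntegral.integral_add]
  · congr 1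
    apply intervalIntegral.integral_congr
    intro y _
    simp only
    push_cast
    rw [sub_mul, add_mul, Real.cos_sub, Real.cos_add, one_mul]
    ring
  all_goals exact Continuous.intervalIntegrable (by fun_prop) _ _

theorem cosCoeff_one (s : ℤ) : cosCoeff (fun _ => 1) s = if s = 0 then 1 else 0 := by
  have hpi := Real.pi_pos
  simp only [cosCoeff, mul_one]
  split_ifs with h
  · simp only [h, Int.cast_zero, zero_mul, Real.cos_zero, intervalIntegral.integral_const,
      smul_eq_mul]
    field_simp
    ring
  · have h' : (s : ℝ) ≠ 0 := by exact_mod_cast h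
    rw [intervalIntegral.integral_comp_mul_left (fun y => Real.cos y) h', integral_cos]
    simp [Real.sin_int_mul_pi]

theorem abs_cosCoeff_le {h : ℝ → ℝ} {C : ℝ} (hC : ∀ y, |h y| ≤ C) (s : ℤ) :
    |cosCoeff h s| ≤ C := by
  have hpi := Real.pi_pos
  have h1 : ‖∫ y in (-Real.pi)..Real.pi, Real.cos (s * y) * h y‖ ≤ C * |Real.pi - -Real.pi| := by
    apply intervalIntegral.norm_integral_le_of_norm_le_const
    intro y _
    rw [Real.norm_eq_abs, abs_mul]
    exact (mul_le_of_le_one_left (abs_nonneg _) (Real.abs_cos_le_one _)).trans (hC y)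
  rw [cosCoeff, abs_mul, abs_of_pos (by positivity)]
  rw [Real.norm_eq_abs, abs_of_pos (show 0 < Real.pi - -Real.pi by linarith)] at h1
  calc (2 * Real.pi)⁻¹ * |∫ y in (-Real.pi)..Real.pi, Real.cos (s * y) * h y|
      ≤ (2 * Real.pi)⁻¹ * (C * (Real.pi - -Real.pi)) := by gcongr
    _ = C := by field_simp; ring

theorem hasSum_cosCoeff {F : ℕ → ℝ → ℝ} {f : ℝ → ℝ} {b : ℕ → ℝ} (hF : ∀ k, Continuous (F k))
    (hb : Summable b) (hFb : ∀ k y, |F k y| ≤ b k) (hf : ∀ y, HasSum (fun k => F k y) (f y))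
    (s : ℤ) : HasSum (fun k => cosCoeff (F k) s) (cosCoeff f s) := by
  refine HasSum.mul_left _ ?_
  refine intervalIntegral.hasSum_integral_of_dominated_convergence (fun k _ => b k) ?_ ?_ ?_ ?_ ?_
  · intro k
    exact Continuous.aestronglyMeasurable (by fun_prop)
  · intro k
    refine ae_of_all _ fun y _ => ?_
    rw [Real.norm_eq_abs, abs_mul]
    exact (mul_le_of_le_one_left (abs_nonneg _) (Real.abs_cos_le_one _)).trans (hFb k y)
  · exact ae_of_all _ fun _ _ => hb
  · simp
  · exact ae_of_all _ fun y _ => (hf y).mul_left _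

end CosineCoefficient

/-! ### Fourier representation of the Green function -/

section Spectral

/-- `1 - (2a/3) cos y`. -/
def vertSymbol (a y : ℝ) : ℝ := 1 - 2 * a / 3 * Real.cos y

@[fun_prop]
theorem continuous_vertSymbol (a : ℝ) : Continuous (vertSymbol a) := by
  unfold vertSymbol; fun_prop

variable {a : ℝ}

theorem vertSymbol_ge (ha : 0 ≤ a) (y : ℝ) : 1 - 2 * a / 3 ≤ vertSymbol a y := by
  have := mul_le_of_le_one_right (show 0 ≤ 2 * a / 3 by positivity) (Real.cos_le_one y)
  unfold vertSymbol; linarith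

theorem vertSymbol_pos (ha : 0 ≤ a) (ha1 : a < 1) (y : ℝ) : 0 < vertSymbol a y := by
  have := vertSymbol_ge ha y
  linarith

theorem vertSymbol_gt (ha : 0 ≤ a) (ha1 : a < 1) (y : ℝ) : a / 3 < vertSymbol a y := by
  have := vertSymbol_ge ha y
  linarith

/-- The spectral form of the Green function. -/
def specGreen (a : ℝ) (x : ℤ × ℤ) : ℝ :=
  if 0 ≤ x.1 then
    cosCoeff (fun y => (a / 3 / vertSymbol a y) ^ x.1.toNat / vertSymbol a y) x.2
  else 0

theorem specGreen_natCast (a : ℝ) (n : ℕ) (s : ℤ) :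
    specGreen a (n, s) = cosCoeff (fun y => (a / 3 / vertSymbol a y) ^ n / vertSymbol a y) s := by
  simp [specGreen]

theorem ratio_nonneg (ha : 0 ≤ a) (ha1 : a < 1) (y : ℝ) : 0 ≤ a / 3 / vertSymbol a y :=
  div_nonneg (by positivity) (vertSymbol_pos ha ha1 y).le

theorem ratio_le_one (ha : 0 ≤ a) (ha1 : a < 1) (y : ℝ) : a / 3 / vertSymbol a y ≤ 1 :=
  (div_le_one (vertSymbol_pos ha ha1 y)).2 (vertSymbol_gt ha ha1 y).le

theorem continuous_ratio (ha : 0 ≤ a) (ha1 : a < 1) :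
    Continuous fun y => a / 3 / vertSymbol a y :=
  continuous_const.div (by fun_prop) fun y => (vertSymbol_pos ha ha1 y).ne'

theorem continuous_specGreen_integrand (ha : 0 ≤ a) (ha1 : a < 1) (n : ℕ) :
    Continuous fun y => (a / 3 / vertSymbol a y) ^ n / vertSymbol a y :=
  ((continuous_ratio ha ha1).pow n).div (by fun_prop) fun y => (vertSymbol_pos ha ha1 y).ne'

theorem abs_specGreen_integrand_le (ha : 0 ≤ a) (ha1 : a < 1) (n : ℕ) (y : ℝ) :
    |(a / 3 / vertSymbol a y) ^ n / vertSymbol a y| ≤ 3 := by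
  have h0 := vertSymbol_pos ha ha1 y
  have h1 := ratio_nonneg ha ha1 y
  have h2 : (a / 3 / vertSymbol a y) ^ n ≤ 1 := pow_le_one₀ h1 (ratio_le_one ha ha1 y)
  rw [abs_of_nonneg (by positivity), div_le_iff₀ h0]
  have := vertSymbol_ge ha y
  linarith

theorem abs_specGreen_le (ha : 0 ≤ a) (ha1 : a < 1) (x : ℤ × ℤ) : |specGreen a x| ≤ 3 := by
  unfold specGreen
  split_ifs
  · exact abs_cosCoeff_le (abs_specGreen_integrand_le ha ha1 _) _
  · simp

/-- On the Fourier side, with v = `vertSymbol a y` and h_n = (a/3/v)^n / v, the equation reads v h_n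
= [n = 0] + (a/3) h_{n-1}: the vertical steps have been absorbed into v, and right steps only lower
n by one. -/
theorem specGreen_eq (ha : 0 ≤ a) (ha1 : a < 1) (x : ℤ × ℤ) :
    specGreen a x = (if x = 0 then 1 else 0) + a / 3 * (specGreen a (x - (1, 0)) +
      specGreen a (x - (0, 1)) + specGreen a (x - (0, -1))) := by
  obtain ⟨t, s⟩ := x
  rcases lt_or_ge t 0 with ht | ht
  · have h0 : ((t, s) : ℤ × ℤ) ≠ 0 := by
      intro h; simp only [Prod.mk_eq_zero] at h; omega
    have h1 : ¬ (1 ≤ t) := by omega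
    simp [specGreen, h0, ht.not_ge, h1]
  obtain ⟨n, rfl⟩ := Int.eq_ofNat_of_zero_le ht
  have hv := fun y => (vertSymbol_pos ha ha1 y).ne'
  have hc := continuous_specGreen_integrand ha ha1 n
  have hc1 : Continuous fun y => 2 * Real.cos y *
      ((a / 3 / vertSymbol a y) ^ n / vertSymbol a y) := by fun_prop
  have e2 : ((n : ℤ), s) - (0, 1) = ((n : ℤ), s - 1) := by ext <;> simp
  have e3 : ((n : ℤ), s) - (0, -1) = ((n : ℤ), s + 1) := by ext <;> simp
  rw [add_assoc (specGreen _ _), e2, e3, specGreen_natCast, specGreen_natCast, specGreen_natCast,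
    cosCoeff_shift hc]
  rcases n with _ | n
  · have e1 : specGreen a (((0 : ℕ) : ℤ) - 1, s) = 0 := by simp [specGreen]
    have e0 : ((((0 : ℕ) : ℤ), s) = (0 : ℤ × ℤ)) ↔ s = 0 := by simp
    simp only [Prod.mk_sub_mk, sub_zero, e1, e0, zero_add]
    rw [← cosCoeff_one, ← cosCoeff_const_mul, ← cosCoeff_add (by fun_prop) (by fun_prop)]
    refine cosCoeff_congr (fun y => ?_) s
    have := hv y
    field_simp
    simp only [vertSymbol]
    ring
  · have e1 : specGreen a ((((n + 1 : ℕ) : ℤ), s) - (1, 0)) = specGreen a (n, s) := by simp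
    have e0 : (((n + 1 : ℕ) : ℤ), s) ≠ (0 : ℤ × ℤ) := by
      intro h; simp only [Prod.mk_eq_zero] at h; omega
    rw [e1, if_neg e0, specGreen_natCast, zero_add,
      ← cosCoeff_add (continuous_specGreen_integrand ha ha1 n) hc1, ← cosCoeff_const_mul]
    refine cosCoeff_congr (fun y => ?_) s
    have := hv y
    rw [pow_succ]
    have h2 : a / 3 / vertSymbol a y * vertSymbol a y = a / 3 := div_mul_cancel₀ _ this
    have h3 : vertSymbol a y = 1 - 2 * a / 3 * Real.cos y := rfl
    field_simp
    rw [h3]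
    ring

/-- For fixed a < 1 both sides are bounded and solve the same inhomogeneous resolvent equation, so
their difference vanishes. -/
theorem green_eq_specGreen (ha : 0 ≤ a) (ha1 : a < 1) (x : ℤ × ℤ) :
    green x a = specGreen a x := by
  have h := eq_zero_of_bounded_of_resolvent ha ha1 (d := fun x => green x a - specGreen a x)
    (C := (1 - a)⁻¹ + 3) (fun x => ?_) (fun x => ?_) x
  · linarith
  · refine (abs_sub _ _).trans (add_le_add ?_ (abs_specGreen_le ha ha1 x))
    rw [abs_of_nonneg (green_nonneg ha x)]
    exact green_le ha ha1 x
  · rw [green_eq ha ha1 x, specGreen_eq ha ha1 x]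
    ring

end Spectral

/-! ### Autocorrelation of the Green function in closed form -/

section Autocorrelation

variable {a : ℝ}

/-- The autocorrelation `∑_u g₃(x + u, a) g₃(u, a)` at `x = (n, s)`, in spectral form. -/
def covKernel (n : ℕ) (s : ℤ) (a : ℝ) : ℝ :=
  cosCoeff (fun y => (a / 3 / vertSymbol a y) ^ n / (vertSymbol a y ^ 2 - (a / 3) ^ 2)) s

theorem summable_transProb_mul (k : ℕ) {f : ℤ × ℤ → ℝ} {C : ℝ} (hC : ∀ x, |f x| ≤ C)
    (x : ℤ × ℤ) : Summable fun u => transProb k u * f (x + u) :=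
  .of_norm_bounded ((hasSum_transProb k).summable.mul_right C) fun u => by
    rw [Real.norm_eq_abs, abs_mul, abs_of_nonneg (transProb_nonneg k u)]
    exact mul_le_mul_of_nonneg_left (hC _) (transProb_nonneg k u)

/-- Reindexing the sum moves one step of the walk from `transProb` onto the argument of f. -/
theorem tsum_transProb_succ_mul (k : ℕ) {f : ℤ × ℤ → ℝ} {C : ℝ} (hC : ∀ x, |f x| ≤ C)
    (x : ℤ × ℤ) : ∑' u, transProb (k + 1) u * f (x + u) =
      3⁻¹ * (∑' u, transProb k u * f (x + (1, 0) + u) + ∑' u, transProb k u * f (x + (0, 1) + u) +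
        ∑' u, transProb k u * f (x + (0, -1) + u)) := by
  have key : ∀ e, HasSum (fun u => transProb k (u - e) * f (x + u))
      (∑' u, transProb k u * f (x + e + u)) := by
    intro e
    rw [← (Equiv.addRight e).hasSum_iff]
    convert (summable_transProb_mul k hC (x + e)).hasSum using 2 with u
    simp [add_assoc, add_comm e]
  have h := ((((key (1, 0)).add (key (0, 1))).add (key (0, -1))).mul_left 3⁻¹).tsum_eq
  rw [← h]
  refine tsum_congr fun u => ?_
  rw [transProb_succ]
  ring

theorem abs_green_le (ha : 0 ≤ a) (ha1 : a < 1) (x : ℤ × ℤ) : |green x a| ≤ 3 := by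
  rw [green_eq_specGreen ha ha1]
  exact abs_specGreen_le ha ha1 x

theorem abs_step_symbol_le (ha : 0 ≤ a) (ha1 : a < 1) (y : ℝ) :
    |(a / 3 / vertSymbol a y + 2 * Real.cos y) / 3| ≤ 1 := by
  have h0 := ratio_nonneg ha ha1 y
  have h1 := ratio_le_one ha ha1 y
  have h2 := Real.neg_one_le_cos y
  have h3 := Real.cos_le_one y
  rw [abs_le]
  constructor <;> linarith

/-- Each step multiplies the symbol by (q + 2 cos y)/3, with q = a/3/v: a right step raises the
power of q by one, the vertical pair contributes 2 cos y. The walk never decreases n, so it stays in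
the half-plane where the single formula q^n / v is valid. -/
theorem tsum_transProb_mul_green (ha : 0 ≤ a) (ha1 : a < 1) (k n : ℕ) (s : ℤ) :
    ∑' u, transProb k u * green (((n : ℤ), s) + u) a =
      cosCoeff (fun y => ((a / 3 / vertSymbol a y + 2 * Real.cos y) / 3) ^ k *
        ((a / 3 / vertSymbol a y) ^ n / vertSymbol a y)) s := by
  induction k generalizing n s with
  | zero =>
    rw [tsum_eq_single 0]
    · simp [transProb_zero, green_eq_specGreen ha ha1, specGreen_natCast]
    · intro u hu
      simp [transProb_zero, hu]
  | succ k ih =>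
    have hr := continuous_ratio ha ha1
    have hg := fun n => continuous_specGreen_integrand ha ha1 n
    have hc : ∀ n, Continuous fun y => ((a / 3 / vertSymbol a y + 2 * Real.cos y) / 3) ^ k *
        ((a / 3 / vertSymbol a y) ^ n / vertSymbol a y) := fun n =>
      Continuous.mul (by fun_prop) (hg n)
    have hc1 : Continuous fun y => 2 * Real.cos y *
        (((a / 3 / vertSymbol a y + 2 * Real.cos y) / 3) ^ k *
        ((a / 3 / vertSymbol a y) ^ n / vertSymbol a y)) := Continuous.mul (by fun_prop) (hc n)
    rw [tsum_transProb_succ_mul k (f := fun x => green x a) (abs_green_le ha ha1)]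
    have e1 : ((n : ℤ), s) + (1, 0) = (((n + 1 : ℕ) : ℤ), s) := by ext <;> simp
    have e2 : ((n : ℤ), s) + (0, 1) = ((n : ℤ), s + 1) := by ext <;> simp
    have e3 : ((n : ℤ), s) + (0, -1) = ((n : ℤ), s - 1) := by ext <;> simp [sub_eq_add_neg]
    rw [e1, e2, e3, ih, ih, ih, add_assoc, add_comm (cosCoeff _ (s + 1)), cosCoeff_shift (hc n),
      ← cosCoeff_add (hc (n + 1)) hc1, ← cosCoeff_const_mul]
    refine cosCoeff_congr (fun y => ?_) s
    ring

theorem summable_pow_mul_transProb (ha : 0 ≤ a) (ha1 : a < 1) :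
    Summable fun p : ℕ × (ℤ × ℤ) => a ^ p.1 * transProb p.1 p.2 := by
  have hpos : 0 ≤ fun p : ℕ × (ℤ × ℤ) => a ^ p.1 * transProb p.1 p.2 := by
    rw [Pi.le_def]
    intro p
    have := transProb_nonneg p.1 p.2
    simp only [Pi.zero_apply]
    positivity
  rw [summable_prod_of_nonneg hpos]
  refine ⟨fun k => (hasSum_transProb k).summable.mul_left (a ^ k), ?_⟩
  simp_rw [tsum_mul_left, (hasSum_transProb _).tsum_eq, mul_one]
  exact summable_geometric_of_lt_one ha ha1

theorem summable_pow_mul_transProb_mul_green (ha : 0 ≤ a) (ha1 : a < 1) (x : ℤ × ℤ) :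
    Summable fun p : ℕ × (ℤ × ℤ) => a ^ p.1 * (transProb p.1 p.2 * green (x + p.2) a) := by
  refine .of_norm_bounded ((summable_pow_mul_transProb ha ha1).mul_right 3) fun p => ?_
  have h := transProb_nonneg p.1 p.2
  have h' := pow_nonneg ha p.1
  rw [Real.norm_eq_abs, ← mul_assoc, abs_mul, abs_of_nonneg (mul_nonneg h' h)]
  exact mul_le_mul_of_nonneg_left (abs_green_le ha ha1 _) (mul_nonneg h' h)

/-- Only the factor `green u a` is expanded as a power series in a. After exchanging the sums over k
and u, the previous lemma leaves a geometric series under the Fourier integral. -/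
theorem hasSum_autocorr_natCast (ha : 0 ≤ a) (ha1 : a < 1) (n : ℕ) (s : ℤ) :
    HasSum (fun u => green (((n : ℤ), s) + u) a * green u a) (covKernel n s a) := by
  let f : ℕ × (ℤ × ℤ) → ℝ := fun p =>
    a ^ p.1 * (transProb p.1 p.2 * green (((n : ℤ), s) + p.2) a)
  have hs : Summable f := summable_pow_mul_transProb_mul_green ha ha1 _
  have h1 : ∀ k, ∑' u, f (k, u) = cosCoeff (fun y => a ^ k *
      (((a / 3 / vertSymbol a y + 2 * Real.cos y) / 3) ^ k *
        ((a / 3 / vertSymbol a y) ^ n / vertSymbol a y))) s := by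
    intro k
    simp only [f]
    rw [tsum_mul_left, tsum_transProb_mul_green ha ha1, cosCoeff_const_mul]
  have h2 : HasSum (fun k => ∑' u, f (k, u)) (covKernel n s a) := by
    simp_rw [h1]
    have hr := continuous_ratio ha ha1
    have hg := continuous_specGreen_integrand ha ha1 n
    refine hasSum_cosCoeff (b := fun k => a ^ k * 3) (fun k => ?_)
      ((summable_geometric_of_lt_one ha ha1).mul_right _) (fun k y => ?_) (fun y => ?_) s
    · exact continuous_const.mul (Continuous.mul (by fun_prop) hg)
    · rw [abs_mul, abs_mul, abs_of_nonneg (pow_nonneg ha k), abs_pow]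
      refine mul_le_mul_of_nonneg_left ?_ (pow_nonneg ha k)
      exact (mul_le_of_le_one_left (abs_nonneg _)
        (pow_le_one₀ (abs_nonneg _) (abs_step_symbol_le ha ha1 y))).trans
        (abs_specGreen_integrand_le ha ha1 n y)
    · have hv := vertSymbol_pos ha ha1 y
      have hv' := vertSymbol_gt ha ha1 y
      have hlt : |a * ((a / 3 / vertSymbol a y + 2 * Real.cos y) / 3)| < 1 := by
        rw [abs_mul, abs_of_nonneg ha]
        exact (mul_le_of_le_one_right ha (abs_step_symbol_le ha ha1 y)).trans_lt ha1
      have h := (hasSum_geometric_of_abs_lt_one hlt).mul_right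
        ((a / 3 / vertSymbol a y) ^ n / vertSymbol a y)
      -- Since (2a/3) cos y = 1 - v, the left side equals v - (a/3)²/v.
      have h3 : 1 - a * ((a / 3 / vertSymbol a y + 2 * Real.cos y) / 3) =
          (vertSymbol a y ^ 2 - (a / 3) ^ 2) / vertSymbol a y := by
        field_simp
        simp only [vertSymbol]
        ring
      have h4 : 0 < vertSymbol a y ^ 2 - (a / 3) ^ 2 := by nlinarith
      have h5 : (a / 3 / vertSymbol a y) ^ n / (vertSymbol a y ^ 2 - (a / 3) ^ 2) =
          (1 - a * ((a / 3 / vertSymbol a y + 2 * Real.cos y) / 3))⁻¹ *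
            ((a / 3 / vertSymbol a y) ^ n / vertSymbol a y) := by
        have := h4.ne'
        rw [h3]
        field_simp
      rw [h5]
      refine h.congr_fun fun k => ?_
      rw [mul_pow, mul_assoc]
  have h3 : Summable fun u => ∑' k, f (k, u) := hs.prod_symm.prod
  have h4 : ∀ u, ∑' k, f (k, u) = green (((n : ℤ), s) + u) a * green u a := by
    intro u
    simp only [f, ← mul_assoc]
    rw [tsum_mul_right, mul_comm]
    rfl
  simp_rw [h4] at h3
  have h5 : ∑' u, ∑' k, f (k, u) = ∑' k, ∑' u, f (k, u) := Summable.tsum_comm hs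
  simp_rw [h4] at h5
  rw [h2.tsum_eq] at h5
  rw [← h5]
  exact h3.hasSum

/-- For t < 0, translating u by (t, s) exchanges the two factors and gives the autocorrelation at
(-t, -s); the kernel is even in s. -/
theorem hasSum_autocorr (ha : 0 ≤ a) (ha1 : a < 1) (t s : ℤ) :
    HasSum (fun u => green ((t, s) + u) a * green u a) (covKernel t.natAbs s a) := by
  rcases le_or_gt 0 t with h | h
  · obtain ⟨n, rfl⟩ := Int.eq_ofNat_of_zero_le h
    exact hasSum_autocorr_natCast ha ha1 n s
  · have h1 := hasSum_autocorr_natCast ha ha1 t.natAbs (-s)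
    rw [covKernel, cosCoeff_neg, ← covKernel] at h1
    rw [← (Equiv.addRight ((t, s) : ℤ × ℤ)).hasSum_iff] at h1
    convert h1 using 2 with u
    have e : ((t.natAbs : ℤ), -s) + (u + (t, s)) = u := by
      have := abs_of_neg h
      ext
      · simp; omega
      · simp
    simp only [Function.comp_apply, Equiv.coe_addRight, e]
    rw [add_comm u, mul_comm]

theorem hasSum_green_mul_green (ha : 0 ≤ a) (ha1 : a < 1) (t s : ℤ) :
    HasSum (fun u => green ((t, s) - u) a * green (0 - u) a) (covKernel t.natAbs s a) := by
  have h := hasSum_autocorr ha ha1 t s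
  rw [← (Equiv.neg (ℤ × ℤ)).hasSum_iff] at h
  convert h using 2 with u
  simp [sub_eq_add_neg]

/-- The factors v - a/3 and v + a/3 are at least 1 - a and 1 - a/3 ≥ 2/3. -/
theorem denom_ge (ha : 0 ≤ a) (ha1 : a < 1) (y : ℝ) :
    (1 - a) / 3 ≤ vertSymbol a y ^ 2 - (a / 3) ^ 2 := by
  have := vertSymbol_ge ha y
  nlinarith

theorem abs_covKernel_le (ha : 0 ≤ a) (ha1 : a < 1) (n : ℕ) (s : ℤ) :
    |covKernel n s a| ≤ 3 / (1 - a) := by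
  refine abs_cosCoeff_le (fun y => ?_) s
  have h0 := ratio_nonneg ha ha1 y
  have h1 : (a / 3 / vertSymbol a y) ^ n ≤ 1 := pow_le_one₀ h0 (ratio_le_one ha ha1 y)
  have h2 := denom_ge ha ha1 y
  have h3 : 0 < (1 - a) / 3 := by linarith
  rw [abs_of_nonneg (div_nonneg (pow_nonneg h0 n) (h3.le.trans h2))]
  calc _ ≤ 1 / ((1 - a) / 3) := by gcongr
    _ = 3 / (1 - a) := by rw [one_div_div]

theorem measurable_covKernel (n : ℕ) (s : ℤ) : Measurable (covKernel n s) := by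
  refine Measurable.const_mul ?_ _
  simp only [intervalIntegral.integral_of_le (neg_le_self Real.pi_pos.le)]
  refine StronglyMeasurable.measurable ?_
  refine StronglyMeasurable.integral_prod_right (f := fun a y => Real.cos (s * y) *
    ((a / 3 / vertSymbol a y) ^ n / (vertSymbol a y ^ 2 - (a / 3) ^ 2))) ?_
  refine Measurable.stronglyMeasurable ?_
  unfold Function.uncurry vertSymbol
  fun_prop

end Autocorrelation

/-! ### Existence of the field and its covariance as a mixture -/

section Field

variable {φ : ℝ → ℝ} {σ β C : ℝ}

/-- Near 1 the bound comes from the asymptotics; on the remaining [0, l] boundedness suffices,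
because (1-a)^β stays at least (1-l)^β there. -/
theorem exists_le_mul_rpow {φ₁ : ℝ} (hφ0 : ∀ a ∈ Set.Ico (0 : ℝ) 1, 0 ≤ φ a)
    (hφbdd : ∃ K : ℝ, ∀ a ∈ Set.Ico (0 : ℝ) 1, φ a ≤ K) (hβ : 0 < β)
    (hφasy : φ ~[𝓝[<] 1] fun a => φ₁ * (1 - a) ^ β) :
    ∃ C, ∀ a ∈ Set.Ico (0 : ℝ) 1, φ a ≤ C * (1 - a) ^ β := by
  obtain ⟨K, hK⟩ := hφbdd
  have hK0 : 0 ≤ K := (hφ0 0 (by simp)).trans (hK 0 (by simp))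
  obtain ⟨c, hc⟩ := hφasy.isBigO.bound
  obtain ⟨l, hl1, hl⟩ := (mem_nhdsLT_iff_exists_Ioo_subset (a := (1 : ℝ))).1 hc
  have hl1' : l < 1 := hl1
  have hp : 0 < (1 - l) ^ β := Real.rpow_pos_of_pos (by linarith) _
  refine ⟨max (c * |φ₁|) (K / (1 - l) ^ β), fun a ha => ?_⟩
  have hpa : 0 < (1 - a) ^ β := Real.rpow_pos_of_pos (by linarith [ha.2]) _
  rcases lt_or_ge l a with h | h
  · have h2 : ‖φ a‖ ≤ c * ‖φ₁ * (1 - a) ^ β‖ := hl ⟨h, ha.2⟩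
    rw [norm_mul, Real.norm_of_nonneg hpa.le, ← mul_assoc] at h2
    exact (Real.le_norm_self _).trans (h2.trans (by gcongr; exact le_max_left _ _))
  · have h3 : (1 - l) ^ β ≤ (1 - a) ^ β := Real.rpow_le_rpow (by linarith) (by linarith) hβ.le
    calc φ a ≤ K := hK a ha
      _ = K / (1 - l) ^ β * (1 - l) ^ β := by field_simp
      _ ≤ K / (1 - l) ^ β * (1 - a) ^ β := by gcongr
      _ ≤ _ := by gcongr; exact le_max_right _ _

theorem ae_mixingMeasure : ∀ᵐ a ∂mixingMeasure φ, a ∈ Set.Ico (0 : ℝ) 1 :=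
  (withDensity_absolutelyContinuous _ _).ae_le (ae_restrict_mem measurableSet_Ico)

theorem ae_prod_mixingMeasure :
    ∀ᵐ p ∂((Measure.count : Measure (ℤ × ℤ)).prod (mixingMeasure φ)), p.2 ∈ Set.Ico (0 : ℝ) 1 :=
  Measure.quasiMeasurePreserving_snd.ae ae_mixingMeasure

instance : SFinite (mixingMeasure φ) := by unfold mixingMeasure; infer_instance

/-- On [0,1) the power series converges, so the function is a pointwise limit of polynomials; the
indicator discards the values of a where convergence is not known. -/
theorem measurable_indicator_green (x : ℤ × ℤ) :
    Measurable ((Set.Ico (0 : ℝ) 1).indicator (green x)) := by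
  refine measurable_of_tendsto_metrizable (f := fun (n : ℕ) => (Set.Ico (0 : ℝ) 1).indicator
    fun a => ∑ k ∈ Finset.range n, a ^ k * transProb k x) (fun n => ?_) ?_
  · exact Measurable.indicator (by fun_prop) measurableSet_Ico
  · rw [tendsto_pi_nhds]
    intro a
    by_cases ha : a ∈ Set.Ico (0 : ℝ) 1
    · simp only [Set.indicator_of_mem ha]
      exact (summable_green ha.1 ha.2 x).hasSum.tendsto_sum_nat
    · simp [Set.indicator_of_notMem ha]

theorem aestronglyMeasurable_green (x : ℤ × ℤ) :
    AEStronglyMeasurable (fun p : (ℤ × ℤ) × ℝ => green (x - p.1) p.2)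
      ((Measure.count : Measure (ℤ × ℤ)).prod (mixingMeasure φ)) := by
  have h : Measurable fun p : (ℤ × ℤ) × ℝ =>
      (Set.Ico (0 : ℝ) 1).indicator (green (x - p.1)) p.2 :=
    measurable_from_prod_countable_right fun u => measurable_indicator_green (x - u)
  refine h.aestronglyMeasurable.congr ?_
  filter_upwards [ae_prod_mixingMeasure] with p hp
  rw [Set.indicator_of_mem hp]

/-- The singularity at a = 1 is at most of order (1-a)^(β-1), integrable exactly because β > 0. -/
theorem integrableOn_mul_covKernel (hφm : Measurable φ)
    (hφ0 : ∀ a ∈ Set.Ico (0 : ℝ) 1, 0 ≤ φ a) (hβ : 0 < β)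
    (hφb : ∀ a ∈ Set.Ico (0 : ℝ) 1, φ a ≤ C * (1 - a) ^ β) (n : ℕ) (s : ℤ) :
    IntegrableOn (fun a => φ a * covKernel n s a) (Set.Ico 0 1) := by
  have h : IntegrableOn (fun a : ℝ => 3 * C * (1 - a) ^ (β - 1)) (Set.Ico 0 1) := by
    refine Integrable.const_mul ?_ _
    have h1 := (intervalIntegral.intervalIntegrable_rpow' (a := 1) (b := 0)
      (show -1 < β - 1 by linarith)).comp_sub_left 1
    simp only [sub_self, sub_zero] at h1
    exact ((intervalIntegrable_iff_integrableOn_Ico_of_le zero_le_one).1 h1)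
  refine h.mono' (hφm.mul (measurable_covKernel n s)).aestronglyMeasurable ?_
  filter_upwards [ae_restrict_mem measurableSet_Ico] with a ha
  have h1 : 0 < 1 - a := by linarith [ha.2]
  rw [norm_mul, Real.norm_of_nonneg (hφ0 a ha), Real.norm_eq_abs, Real.rpow_sub_one h1.ne']
  calc φ a * |covKernel n s a| ≤ C * (1 - a) ^ β * (3 / (1 - a)) :=
        mul_le_mul (hφb a ha) (abs_covKernel_le ha.1 ha.2 n s) (abs_nonneg _)
          ((hφ0 a ha).trans (hφb a ha))
    _ = _ := by ring

theorem integrable_mixingMeasure_iff (hφm : Measurable φ)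
    (hφ0 : ∀ a ∈ Set.Ico (0 : ℝ) 1, 0 ≤ φ a) (g : ℝ → ℝ) :
    Integrable g (mixingMeasure φ) ↔ IntegrableOn (fun a => φ a * g a) (Set.Ico 0 1) := by
  rw [mixingMeasure, integrable_withDensity_iff_integrable_smul' (by fun_prop) (by simp)]
  apply integrable_congr
  filter_upwards [ae_restrict_mem measurableSet_Ico] with a ha
  rw [ENNReal.toReal_ofReal (hφ0 a ha), smul_eq_mul]

theorem integral_mixingMeasure (hφm : Measurable φ)
    (hφ0 : ∀ a ∈ Set.Ico (0 : ℝ) 1, 0 ≤ φ a) (g : ℝ → ℝ) :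
    ∫ a, g a ∂mixingMeasure φ = ∫ a in Set.Ico 0 1, φ a * g a := by
  rw [mixingMeasure, integral_withDensity_eq_integral_toReal_smul (by fun_prop) (by simp)]
  apply integral_congr_ae
  filter_upwards [ae_restrict_mem measurableSet_Ico] with a ha
  rw [ENNReal.toReal_ofReal (hφ0 a ha), smul_eq_mul]

theorem integral_count_of_hasSum {f : ℤ × ℤ → ℝ} {b : ℝ} (h : HasSum f b) :
    ∫ u, f u ∂Measure.count = b := by
  rw [integral_countable (integrable_count_iff.2 h.summable.norm)]
  simp [Measure.real, h.tsum_eq]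

/-- For fixed a, translation invariance makes the sum of squares over the lattice equal to
`covKernel 0 0 a`, which leaves a one-dimensional integral against φ. -/
theorem memLp_green (hφm : Measurable φ)
    (hφ0 : ∀ a ∈ Set.Ico (0 : ℝ) 1, 0 ≤ φ a) (hβ : 0 < β)
    (hφb : ∀ a ∈ Set.Ico (0 : ℝ) 1, φ a ≤ C * (1 - a) ^ β) (x : ℤ × ℤ) :
    MemLp (fun p : (ℤ × ℤ) × ℝ => green (x - p.1) p.2) 2 (controlMeasure σ φ) := by
  refine MemLp.smul_measure ?_ ENNReal.ofReal_ne_top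
  have hm := aestronglyMeasurable_green (φ := φ) x
  rw [memLp_two_iff_integrable_sq hm, integrable_prod_iff' (by exact hm.pow 2)]
  have hsum : ∀ a ∈ Set.Ico (0 : ℝ) 1,
      HasSum (fun u => green (x - u) a ^ 2) (covKernel 0 0 a) := by
    intro a ha
    have h := hasSum_green_mul_green ha.1 ha.2 0 0
    rw [← (Equiv.subRight x).hasSum_iff] at h
    refine h.congr_fun fun u => ?_
    have e : ((0, 0) : ℤ × ℤ) = 0 := rfl
    simp [e, sq]
  constructor
  · filter_upwards [ae_mixingMeasure] with a ha
    exact integrable_count_iff.2 (hsum a ha).summable.norm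
  · have h := (integrable_mixingMeasure_iff hφm hφ0 _).2
      (integrableOn_mul_covKernel hφm hφ0 hβ hφb 0 0)
    refine h.congr ?_
    filter_upwards [ae_mixingMeasure] with a ha
    rw [← integral_count_of_hasSum (hsum a ha)]
    simp

variable {Ω : Type*} [MeasurableSpace Ω] {P : Measure Ω} [IsProbabilityMeasure P]
  {M : Set ((ℤ × ℤ) × ℝ) → Ω → ℝ}

theorem exists_isAggregatedField (hM : IsGaussianRandomMeasure P (controlMeasure σ φ) M)
    (hφm : Measurable φ) (hφ0 : ∀ a ∈ Set.Ico (0 : ℝ) 1, 0 ≤ φ a) (hβ : 0 < β)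
    (hφb : ∀ a ∈ Set.Ico (0 : ℝ) 1, φ a ≤ C * (1 - a) ^ β) :
    ∃ X : ℤ × ℤ → Ω → ℝ, IsAggregatedField P σ φ M X := by
  choose X hX using fun x => exists_isStochasticIntegral hM
    (memLp_green (σ := σ) hφm hφ0 hβ hφb x)
  exact ⟨X, hX⟩

/-- Itô isometry, then Fubini: the sum over the lattice is the autocorrelation already computed. -/
theorem covFun_eq (hM : IsGaussianRandomMeasure P (controlMeasure σ φ) M)
    (hφm : Measurable φ) (hφ0 : ∀ a ∈ Set.Ico (0 : ℝ) 1, 0 ≤ φ a) (hβ : 0 < β)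
    (hφb : ∀ a ∈ Set.Ico (0 : ℝ) 1, φ a ≤ C * (1 - a) ^ β) {X : ℤ × ℤ → Ω → ℝ}
    (hX : IsAggregatedField P σ φ M X) (t s : ℤ) :
    covFun P X t s = σ ^ 2 * ∫ a in Set.Ico 0 1, φ a * covKernel t.natAbs s a := by
  -- Taking variance factor 1 gives square-integrability for the bare product measure, which covers
  -- σ = 0 as well.
  have hL := fun x => memLp_green (σ := 1) hφm hφ0 hβ hφb x
  simp only [controlMeasure, one_pow, ENNReal.ofReal_one, one_smul] at hL
  have hI : Integrable (fun p : (ℤ × ℤ) × ℝ => green ((t, s) - p.1) p.2 * green ((0, 0) - p.1) p.2)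
      ((Measure.count : Measure (ℤ × ℤ)).prod (mixingMeasure φ)) :=
    (hL (t, s)).integrable_mul (hL (0, 0))
  rw [covFun, (hX (t, s)).integral_mul hM (hX (0, 0)), controlMeasure, integral_smul_measure,
    ENNReal.toReal_ofReal (sq_nonneg σ), smul_eq_mul]
  congr 1
  rw [integral_prod_symm _ hI, ← integral_mixingMeasure hφm hφ0]
  refine integral_congr_ae ?_
  filter_upwards [ae_mixingMeasure] with a ha
  exact integral_count_of_hasSum (hasSum_green_mul_green ha.1 ha.2 t s)

end Field

/-! ### Zooming in on a = 1 in the mixture -/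

section MixtureLimit

variable {φ : ℝ → ℝ} {β C φ₁ : ℝ}

theorem tendsto_rpow_mul_mixing (hφ₁ : 0 < φ₁) (hφasy : φ ~[𝓝[<] 1] fun a => φ₁ * (1 - a) ^ β)
    {δ : ℝ} (hδ : 0 < δ) :
    Tendsto (fun l : ℝ => l ^ β * φ (1 - δ / l)) atTop (𝓝 (φ₁ * δ ^ β)) := by
  have h1 : Tendsto (fun l : ℝ => 1 - δ / l) atTop (𝓝[<] 1) := by
    refine tendsto_nhdsWithin_iff.2 ⟨?_, ?_⟩
    · simpa using (tendsto_const_nhds (x := (1 : ℝ))).sub (tendsto_const_nhds.div_atTop tendsto_id)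
    · filter_upwards [eventually_gt_atTop 0] with l hl
      simp only [Set.mem_Iio, sub_lt_self_iff]
      positivity
  have h2 := (IsEquivalent.refl (u := fun l : ℝ => l ^ β) (l := atTop)).mul
    (hφasy.comp_tendsto h1)
  have hne : φ₁ * δ ^ β ≠ 0 := by positivity
  refine (isEquivalent_const_iff_tendsto hne).1 (h2.congr_right ?_)
  filter_upwards [eventually_gt_atTop 0] with l hl
  simp only [Pi.mul_apply, Function.comp_apply, sub_sub_cancel]
  rw [Real.div_rpow hδ.le hl.le]
  have : 0 < l ^ β := by positivity
  field_simp
  rfl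

/-- With a = 1 - δ/l the Jacobian is 1/l; the remaining power β - 1/2 is shared as l^β for φ and
l^(-1/2) for the kernel. -/
theorem rescale_mixing_integral {k : ℝ → ℝ} {l : ℝ} (hl : 0 < l) :
    l ^ (β + 1 / 2) * ∫ a in Set.Ico 0 1, φ a * k a =
      ∫ δ in Set.Ioi 0, (Set.Ioo 0 l).indicator
        (fun δ => (l ^ β * φ (1 - δ / l)) * (l ^ (-(1 / 2) : ℝ) * k (1 - δ / l))) δ := by
  have h := intervalIntegral.integral_comp_sub_div (a := 0) (b := l) (fun a => φ a * k a) hl.ne' 1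
  rw [div_self hl.ne', zero_div, sub_self, sub_zero, smul_eq_mul] at h
  rw [setIntegral_indicator measurableSet_Ioo,
    Set.inter_eq_self_of_subset_right Set.Ioo_subset_Ioi_self,
    ← integral_Ioc_eq_integral_Ioo, ← intervalIntegral.integral_of_le hl.le,
    integral_Ico_eq_integral_Ioo, ← integral_Ioc_eq_integral_Ioo,
    ← intervalIntegral.integral_of_le zero_le_one]
  have e : ∀ δ : ℝ, (l ^ β * φ (1 - δ / l)) * (l ^ (-(1 / 2) : ℝ) * k (1 - δ / l)) =
      (l ^ β * l ^ (-(1 / 2) : ℝ)) * (φ (1 - δ / l) * k (1 - δ / l)) := fun δ => by ring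
  simp_rw [e]
  rw [intervalIntegral.integral_const_mul, h, ← mul_assoc]
  congr 1
  rw [← Real.rpow_add hl, ← Real.rpow_add_one hl.ne']
  congr 1
  ring

/-- Dominated convergence for the mixture of a rescaled kernel over `a = 1 - δ / l`. -/
theorem tendsto_mixture (hφm : Measurable φ)
    (hφ0 : ∀ a ∈ Set.Ico (0 : ℝ) 1, 0 ≤ φ a) (hφ₁ : 0 < φ₁)
    (hφb : ∀ a ∈ Set.Ico (0 : ℝ) 1, φ a ≤ C * (1 - a) ^ β)
    (hφasy : φ ~[𝓝[<] 1] fun a => φ₁ * (1 - a) ^ β)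
    {k : ℝ → ℝ → ℝ} {kinf B : ℝ → ℝ} (hk : ∀ l, Measurable (k l))
    (hB : ∀ᶠ l : ℝ in atTop, ∀ δ ∈ Set.Ioo 0 l, |l ^ (-(1 / 2) : ℝ) * k l (1 - δ / l)| ≤ B δ)
    (hBint : IntegrableOn (fun δ => δ ^ β * B δ) (Set.Ioi 0))
    (hlim : ∀ δ, 0 < δ →
      Tendsto (fun l : ℝ => l ^ (-(1 / 2) : ℝ) * k l (1 - δ / l)) atTop (𝓝 (kinf δ))) :
    Tendsto (fun l : ℝ => l ^ (β + 1 / 2) * ∫ a in Set.Ico 0 1, φ a * k l a) atTop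
      (𝓝 (∫ δ in Set.Ioi 0, φ₁ * δ ^ β * kinf δ)) := by
  have h : Tendsto (fun l : ℝ => ∫ δ in Set.Ioi 0, (Set.Ioo 0 l).indicator
        (fun δ => (l ^ β * φ (1 - δ / l)) * (l ^ (-(1 / 2) : ℝ) * k l (1 - δ / l))) δ) atTop
      (𝓝 (∫ δ in Set.Ioi 0, φ₁ * δ ^ β * kinf δ)) := by
    -- The power bound on φ gives l^β φ(1 - δ/l) ≤ C δ^β uniformly in l.
    refine tendsto_integral_filter_of_dominated_convergence (fun δ => |C| * (δ ^ β * |B δ|))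
      ?_ ?_ ?_ ?_
    · refine Eventually.of_forall fun l => ?_
      refine (Measurable.indicator ?_ measurableSet_Ioo).aestronglyMeasurable
      have := hk l
      fun_prop
    · filter_upwards [hB, eventually_gt_atTop 0] with l hl hl0
      filter_upwards [ae_restrict_mem measurableSet_Ioi] with δ (hδ : 0 < δ)
      by_cases hm : δ ∈ Set.Ioo 0 l
      · rw [Set.indicator_of_mem hm, norm_mul]
        have ha : 1 - δ / l ∈ Set.Ico (0 : ℝ) 1 := by
          have h1 : δ / l < 1 := (div_lt_one hl0).2 hm.2
          have h2 : 0 < δ / l := by positivity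
          constructor <;> linarith
        have h1 : ‖l ^ β * φ (1 - δ / l)‖ ≤ |C| * δ ^ β := by
          have hp : 0 < l ^ β := by positivity
          rw [norm_mul, Real.norm_of_nonneg (hφ0 _ ha), Real.norm_of_nonneg hp.le]
          have h2 := hφb _ ha
          rw [sub_sub_cancel, Real.div_rpow hδ.le hl0.le] at h2
          calc l ^ β * φ (1 - δ / l) ≤ l ^ β * (C * (δ ^ β / l ^ β)) := by gcongr
            _ = C * δ ^ β := by field_simp
            _ ≤ |C| * δ ^ β := by gcongr; exact le_abs_self C
        calc _ ≤ |C| * δ ^ β * |B δ| :=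
              mul_le_mul h1 ((hl δ hm).trans (le_abs_self _)) (abs_nonneg _) (by positivity)
          _ = _ := by ring
      · rw [Set.indicator_of_notMem hm, norm_zero]
        positivity
    · refine Integrable.const_mul ?_ _
      refine hBint.norm.congr ?_
      filter_upwards [ae_restrict_mem measurableSet_Ioi] with δ (hδ : 0 < δ)
      rw [norm_mul, Real.norm_of_nonneg (by positivity), Real.norm_eq_abs]
    · filter_upwards [ae_restrict_mem measurableSet_Ioi] with δ (hδ : 0 < δ)
      refine ((tendsto_rpow_mul_mixing hφ₁ hφasy hδ).mul (hlim δ hδ)).congr' ?_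
      filter_upwards [eventually_gt_atTop δ] with l hl
      rw [Set.indicator_of_mem (show δ ∈ Set.Ioo 0 l from ⟨hδ, hl⟩)]
  refine h.congr' ?_
  filter_upwards [eventually_gt_atTop 0] with l hl
  rw [rescale_mixing_integral hl]

end MixtureLimit

/-! ### Scaling limit of the kernel for t ≠ 0 -/

section ScaledKernel

theorem tendsto_mul_one_sub_cos (x : ℝ) :
    Tendsto (fun l : ℝ => l * (1 - Real.cos (x / √l))) atTop (𝓝 (x ^ 2 / 2)) := by
  have h : Tendsto (fun l : ℝ => x / √l / 2) atTop (𝓝 0) := by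
    simpa using ((tendsto_const_nhds (x := x)).div_atTop Real.tendsto_sqrt_atTop).div_const 2
  have h2 := ((Real.continuous_sinc.tendsto 0).comp h).pow 2 |>.const_mul (x ^ 2 / 2)
  rw [Real.sinc_zero, one_pow, mul_one] at h2
  refine h2.congr' ?_
  filter_upwards [eventually_gt_atTop 0] with l hl
  have hs : √l ^ 2 = l := Real.sq_sqrt hl.le
  have hs0 : 0 < √l := Real.sqrt_pos.2 hl
  have hcos : Real.cos (x / √l) = 1 - 2 * Real.sin (x / √l / 2) ^ 2 := by
    have h3 := Real.cos_two_mul (x / √l / 2)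
    rw [mul_div_cancel₀ _ (two_ne_zero)] at h3
    rw [h3, Real.cos_sq']
    ring
  have hsin : Real.sin (x / √l / 2) = x / √l / 2 * Real.sinc (x / √l / 2) := by
    rcases eq_or_ne (x / √l / 2) 0 with h0 | h0
    · rw [h0]; simp
    · rw [Real.sinc_of_ne_zero h0, mul_div_assoc', mul_div_cancel_left₀ _ h0]
  rw [hcos, hsin, Function.comp_apply, mul_pow, div_pow, div_pow, hs]
  field_simp
  ring

theorem cos_le_of_abs_le_pi {y : ℝ} (hy : |y| ≤ Real.pi) : y ^ 2 / 5 ≤ 1 - Real.cos y := by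
  have h := Real.cos_le_one_sub_mul_cos_sq hy
  have hpi : Real.pi ^ 2 ≤ 10 := by nlinarith [Real.pi_lt_d2, Real.pi_pos]
  have h2 : (1 : ℝ) / 5 ≤ 2 / Real.pi ^ 2 := by
    rw [div_le_div_iff₀ (by norm_num) (by positivity)]
    linarith
  nlinarith [sq_nonneg y]

/-- The gap equals (1-a) + (2a/3)(1 - cos y), whose quadratic part degenerates as a → 0. There y² ≤
10 lets the term 1 - a pay for (1-a) y²/20. -/
theorem gap_ge {a y : ℝ} (ha : 0 ≤ a) (ha1 : a ≤ 1) (hy : |y| ≤ Real.pi) :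
    ((1 - a) + y ^ 2) / 20 ≤ vertSymbol a y - a / 3 := by
  have h := cos_le_of_abs_le_pi hy
  have hy2 : y ^ 2 ≤ 10 := by
    have h1 : y ^ 2 ≤ Real.pi ^ 2 := sq_le_sq.2 (by rwa [abs_of_pos Real.pi_pos])
    nlinarith [Real.pi_lt_d2, Real.pi_pos]
  unfold vertSymbol
  nlinarith [mul_le_mul_of_nonneg_left h ha, mul_nonneg (sub_nonneg.2 ha1) (sub_nonneg.2 hy2),
    mul_nonneg ha (sq_nonneg y)]

/-- The ratio is 1 - (v - a/3)/v with v ≤ 5/3, and 1 - u ≤ exp(-u). -/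
theorem ratio_pow_le {a y : ℝ} (ha : 0 ≤ a) (ha1 : a < 1) (n : ℕ) :
    (a / 3 / vertSymbol a y) ^ n ≤ Real.exp (-(3 / 5 * (n * (vertSymbol a y - a / 3)))) := by
  have hv := vertSymbol_pos ha ha1 y
  have hv' := vertSymbol_gt ha ha1 y
  have hv2 : vertSymbol a y ≤ 5 / 3 := by
    unfold vertSymbol
    nlinarith [Real.neg_one_le_cos y]
  have h1 : a / 3 / vertSymbol a y ≤ Real.exp (-(3 / 5 * (vertSymbol a y - a / 3))) := by
    refine le_trans ?_ (Real.add_one_le_exp _)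
    rw [div_le_iff₀ hv]
    nlinarith
  calc _ ≤ Real.exp (-(3 / 5 * (vertSymbol a y - a / 3))) ^ n :=
        pow_le_pow_left₀ (ratio_nonneg ha ha1 y) h1 n
    _ = _ := by
      rw [← Real.exp_nat_mul]
      congr 1
      ring

/-- The integrand of `covKernel`. -/
def covIntegrand (n : ℕ) (s : ℤ) (a y : ℝ) : ℝ :=
  Real.cos (s * y) * ((a / 3 / vertSymbol a y) ^ n / (vertSymbol a y ^ 2 - (a / 3) ^ 2))

/-- The substitution y = x/√l contributes a second factor l^(-1/2); the indicator lets the integrals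
for all l live on the whole line. -/
theorem rescale_covKernel (n : ℕ) (s : ℤ) (a : ℝ) {l : ℝ} (hl : 0 < l) :
    l ^ (-(1 / 2) : ℝ) * covKernel n s a = (2 * Real.pi)⁻¹ *
      ∫ x, (Set.Ioc (-(√l * Real.pi)) (√l * Real.pi)).indicator
        (fun x => l⁻¹ * covIntegrand n s a (x / √l)) x := by
  have hs0 : 0 < √l := Real.sqrt_pos.2 hl
  have h := intervalIntegral.integral_comp_div (a := -(√l * Real.pi)) (b := √l * Real.pi)
    (covIntegrand n s a) hs0.ne'
  have hpi := Real.pi_pos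
  rw [integral_indicator measurableSet_Ioc, ← intervalIntegral.integral_of_le
    (neg_le_self (by positivity)), intervalIntegral.integral_const_mul, h, neg_div,
    mul_div_cancel_left₀ _ hs0.ne', smul_eq_mul, covKernel, cosCoeff, mul_left_comm]
  congr 1
  rw [← mul_assoc]
  congr 1
  rw [Real.rpow_neg hl.le, ← Real.sqrt_eq_rpow]
  nth_rw 2 [← Real.sq_sqrt hl.le]
  field_simp

/-- By `gap_ge`, l(v - a/3) ≥ (δ + x²)/20. With v + a/3 ≥ 1/3 the denominator is at least δ/60, and
the rate 3κ/100 is (3/5)·(κ/20) from `ratio_pow_le`. -/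
theorem abs_scaled_covIntegrand_le {n : ℕ} {s : ℤ} {l δ κ x : ℝ} (hκ : 0 < κ)
    (hn : κ * l ≤ n) (hδ : δ ∈ Set.Ioo 0 l) (hx : |x / √l| ≤ Real.pi) :
    |l⁻¹ * covIntegrand n s (1 - δ / l) (x / √l)| ≤
      60 * δ⁻¹ * Real.exp (-(3 * κ / 100 * δ)) * Real.exp (-(3 * κ / 100) * x ^ 2) := by
  have hl : 0 < l := hδ.1.trans hδ.2
  have hδl : δ / l < 1 := (div_lt_one hl).2 hδ.2
  have hδl0 : 0 < δ / l := div_pos hδ.1 hl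
  have ha : 0 ≤ 1 - δ / l := by linarith
  have ha1 : 1 - δ / l < 1 := by linarith
  set a := 1 - δ / l with hadef
  set y := x / √l with hydef
  have hy2 : l * y ^ 2 = x ^ 2 := by
    rw [hydef, div_pow, Real.sq_sqrt hl.le]; field_simp
  have hε : l * (1 - a) = δ := by rw [hadef]; field_simp; ring
  have hgap := gap_ge ha ha1.le hx
  have hpow := ratio_pow_le (y := y) ha ha1 n
  have hq := pow_nonneg (ratio_nonneg ha ha1 y) n
  set E := vertSymbol a y - a / 3 with hE
  have hlE : (δ + x ^ 2) / 20 ≤ l * E := by nlinarith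
  have hD : 1 / 3 ≤ vertSymbol a y + a / 3 := by
    have := vertSymbol_ge ha y; linarith
  have hlE0 : δ / 20 ≤ l * E := by nlinarith [sq_nonneg x]
  have hfac : l * (vertSymbol a y ^ 2 - (a / 3) ^ 2) = (l * E) * (vertSymbol a y + a / 3) := by
    rw [hE]; ring
  have hden : δ / 60 ≤ l * (vertSymbol a y ^ 2 - (a / 3) ^ 2) := by
    rw [hfac]; nlinarith [hδ.1]
  have hnE : κ * ((δ + x ^ 2) / 20) ≤ n * E := by
    have hE0 : 0 ≤ E := by rw [hE]; linarith [vertSymbol_gt ha ha1 y]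
    nlinarith
  have hexp : (a / 3 / vertSymbol a y) ^ n ≤ Real.exp (-(3 * κ / 100 * δ) + -(3 * κ / 100) * x ^ 2) := by
    refine hpow.trans (Real.exp_le_exp.2 ?_)
    linarith
  have hδ0 := hδ.1
  have e : l⁻¹ * covIntegrand n s a y = Real.cos (s * y) *
      ((a / 3 / vertSymbol a y) ^ n / (l * (vertSymbol a y ^ 2 - (a / 3) ^ 2))) := by
    rw [covIntegrand, mul_left_comm, mul_comm l, ← div_div, div_eq_inv_mul _ l]
  have hden0 : 0 < l * (vertSymbol a y ^ 2 - (a / 3) ^ 2) := by linarith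
  rw [e, abs_mul, abs_of_nonneg (div_nonneg hq hden0.le)]
  calc _ ≤ 1 * ((a / 3 / vertSymbol a y) ^ n / (l * (vertSymbol a y ^ 2 - (a / 3) ^ 2))) := by
        gcongr
        exact Real.abs_cos_le_one _
    _ ≤ Real.exp (-(3 * κ / 100 * δ) + -(3 * κ / 100) * x ^ 2) / (δ / 60) := by
        rw [one_mul]; gcongr
    _ = _ := by rw [Real.exp_add]; field_simp

theorem eventually_mul_le_natCast {N : ℝ → ℕ} {τ : ℝ} (hτ : 0 < τ)
    (hN : Tendsto (fun l => (N l : ℝ) / l) atTop (𝓝 τ)) :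
    ∀ᶠ l : ℝ in atTop, τ / 2 * l ≤ N l := by
  filter_upwards [hN.eventually (lt_mem_nhds (half_lt_self hτ)), eventually_gt_atTop 0] with l h hl
  rw [lt_div_iff₀ hl] at h
  exact h.le

theorem indicator_scaled_le {n : ℕ} {s : ℤ} {l δ κ : ℝ} (hκ : 0 < κ)
    (hn : κ * l ≤ n) (hδ : δ ∈ Set.Ioo 0 l) (x : ℝ) :
    ‖(Set.Ioc (-(√l * Real.pi)) (√l * Real.pi)).indicator
        (fun x => l⁻¹ * covIntegrand n s (1 - δ / l) (x / √l)) x‖ ≤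
      60 * δ⁻¹ * Real.exp (-(3 * κ / 100 * δ)) * Real.exp (-(3 * κ / 100) * x ^ 2) := by
  have hl : 0 < l := hδ.1.trans hδ.2
  have hs0 : 0 < √l := Real.sqrt_pos.2 hl
  have hδ0 := hδ.1
  by_cases hx : x ∈ Set.Ioc (-(√l * Real.pi)) (√l * Real.pi)
  · rw [Set.indicator_of_mem hx]
    refine abs_scaled_covIntegrand_le hκ hn hδ ?_
    rw [abs_div, abs_of_pos hs0, div_le_iff₀ hs0, mul_comm]
    exact abs_le.2 ⟨hx.1.le, hx.2⟩
  · rw [Set.indicator_of_notMem hx, norm_zero]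
    positivity

/-- The majorant for the δ-integral: of order δ⁻¹ at 0, hence integrable against δ^β, and
exponentially small at infinity because n grows like τ l with τ > 0. -/
theorem abs_scaled_covKernel_le {N : ℝ → ℕ} {S : ℝ → ℤ} {τ : ℝ} (hτ : 0 < τ)
    (hN : Tendsto (fun l => (N l : ℝ) / l) atTop (𝓝 τ)) :
    ∀ᶠ l : ℝ in atTop, ∀ δ ∈ Set.Ioo 0 l,
      |l ^ (-(1 / 2) : ℝ) * covKernel (N l) (S l) (1 - δ / l)| ≤
        (2 * Real.pi)⁻¹ * (∫ x : ℝ, Real.exp (-(3 * (τ / 2) / 100) * x ^ 2)) * 60 *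
          (δ⁻¹ * Real.exp (-(3 * (τ / 2) / 100 * δ))) := by
  filter_upwards [eventually_mul_le_natCast hτ hN] with l hl δ hδ
  have hpi := Real.pi_pos
  have hδ0 := hδ.1
  have hg : Integrable fun x : ℝ => 60 * δ⁻¹ * Real.exp (-(3 * (τ / 2) / 100 * δ)) *
      Real.exp (-(3 * (τ / 2) / 100) * x ^ 2) :=
    (integrable_exp_neg_mul_sq (by positivity)).const_mul _
  have h := norm_integral_le_of_norm_le hg
    (ae_of_all _ (indicator_scaled_le (s := S l) (half_pos hτ) hl hδ))
  rw [rescale_covKernel _ _ _ (hδ.1.trans hδ.2), abs_mul, abs_of_pos (by positivity)]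
  rw [Real.norm_eq_abs, integral_const_mul] at h
  calc _ ≤ (2 * Real.pi)⁻¹ * _ := mul_le_mul_of_nonneg_left h (by positivity)
    _ = _ := by ring

/-- The scaling limit of `covKernel`. -/
def limKernel (τ s δ : ℝ) : ℝ :=
  (2 * Real.pi)⁻¹ * ∫ x : ℝ,
    Real.cos (s * x) * (Real.exp (-(τ * (3 * δ + x ^ 2))) / (2 / 3 * (δ + x ^ 2 / 3)))

theorem tendsto_scaled_covIntegrand {N : ℝ → ℕ} {S : ℝ → ℤ} {τ s δ : ℝ}
    (hN : Tendsto (fun l => (N l : ℝ) / l) atTop (𝓝 τ))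
    (hS : Tendsto (fun l => (S l : ℝ) / √l) atTop (𝓝 s)) (hδ : 0 < δ) (x : ℝ) :
    Tendsto (fun l : ℝ => l⁻¹ * covIntegrand (N l) (S l) (1 - δ / l) (x / √l)) atTop
      (𝓝 (Real.cos (s * x) *
        (Real.exp (-(τ * (3 * δ + x ^ 2))) / (2 / 3 * (δ + x ^ 2 / 3))))) := by
  have ha : Tendsto (fun l : ℝ => 1 - δ / l) atTop (𝓝 1) := by
    simpa using (tendsto_const_nhds (x := (1 : ℝ))).sub (tendsto_const_nhds.div_atTop tendsto_id)
  have hy : Tendsto (fun l : ℝ => x / √l) atTop (𝓝 0) :=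
    tendsto_const_nhds.div_atTop Real.tendsto_sqrt_atTop
  have hc := (Real.continuous_cos.tendsto 0).comp hy
  rw [Real.cos_zero] at hc
  have hD : Tendsto (fun l : ℝ => vertSymbol (1 - δ / l) (x / √l)) atTop (𝓝 (1 / 3)) := by
    have := (tendsto_const_nhds (x := (1 : ℝ))).sub (((ha.const_mul 2).div_const 3).mul hc)
    have e : (1 : ℝ) - 2 * 1 / 3 * 1 = 1 / 3 := by norm_num
    rw [e] at this
    exact this
  have hE : Tendsto (fun l : ℝ => l * (vertSymbol (1 - δ / l) (x / √l) - (1 - δ / l) / 3)) atTop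
      (𝓝 (δ + x ^ 2 / 3)) := by
    have h := (((ha.const_mul 2).div_const 3).mul (tendsto_mul_one_sub_cos x)).const_add δ
    have e : δ + 2 * 1 / 3 * (x ^ 2 / 2) = δ + x ^ 2 / 3 := by ring
    rw [e] at h
    refine h.congr' ?_
    filter_upwards [eventually_gt_atTop 0] with l hl
    simp only [vertSymbol]
    field_simp
    ring
  have hcosx : Tendsto (fun l : ℝ => Real.cos (S l * (x / √l))) atTop (𝓝 (Real.cos (s * x))) := by
    refine (Real.continuous_cos.tendsto _).comp ?_
    refine (hS.mul_const x).congr fun l => ?_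
    ring
  -- The N-th power is written as exp((N/l) · l log(1 - ε)) with ε = (v - a/3)/v; here l ε tends to
  -- 3(δ + x²/3).
  have hlog : Tendsto (fun l : ℝ => l * Real.log (1 + -((vertSymbol (1 - δ / l) (x / √l) -
      (1 - δ / l) / 3) / vertSymbol (1 - δ / l) (x / √l)))) atTop (𝓝 (-(3 * δ + x ^ 2))) := by
    apply Real.tendsto_mul_log_one_add_of_tendsto
    have h := (hE.div hD (by norm_num)).neg
    have e : -((δ + x ^ 2 / 3) / (1 / 3)) = -(3 * δ + x ^ 2) := by ring
    rw [e] at h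
    refine h.congr fun l => ?_
    simp only [Pi.div_apply]
    ring
  have hpow : Tendsto (fun l : ℝ => ((1 - δ / l) / 3 / vertSymbol (1 - δ / l) (x / √l)) ^ N l)
      atTop (𝓝 (Real.exp (-(τ * (3 * δ + x ^ 2))))) := by
    have h := (Real.continuous_exp.tendsto _).comp (hN.mul hlog)
    rw [mul_neg] at h
    refine h.congr' ?_
    filter_upwards [eventually_gt_atTop δ] with l hl
    have hl0 : 0 < l := hδ.trans hl
    have h1 : δ / l < 1 := (div_lt_one hl0).2 hl
    have h0 : 0 < δ / l := div_pos hδ hl0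
    have hv := vertSymbol_pos (a := 1 - δ / l) (by linarith) (by linarith) (x / √l)
    have e : 1 + -((vertSymbol (1 - δ / l) (x / √l) - (1 - δ / l) / 3) /
        vertSymbol (1 - δ / l) (x / √l)) = (1 - δ / l) / 3 / vertSymbol (1 - δ / l) (x / √l) := by
      rw [sub_div _ _ (vertSymbol _ _), div_self hv.ne']; ring
    have hpos : 0 < (1 - δ / l) / 3 / vertSymbol (1 - δ / l) (x / √l) :=
      div_pos (by linarith) hv
    rw [Function.comp_apply, e, ← mul_assoc, div_mul_cancel₀ _ hl0.ne', Real.exp_nat_mul,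
      Real.exp_log hpos]
  have hden : Tendsto (fun l : ℝ => l * (vertSymbol (1 - δ / l) (x / √l) ^ 2 -
      ((1 - δ / l) / 3) ^ 2)) atTop (𝓝 (2 / 3 * (δ + x ^ 2 / 3))) := by
    have h := hE.mul (hD.add (ha.div_const 3))
    have e : (δ + x ^ 2 / 3) * (1 / 3 + 1 / 3) = 2 / 3 * (δ + x ^ 2 / 3) := by ring
    rw [e] at h
    refine h.congr fun l => ?_
    ring
  refine (hcosx.mul (hpow.div hden (by positivity))).congr fun l => ?_
  simp only [Pi.div_apply]
  rw [covIntegrand, mul_left_comm, mul_comm l, ← div_div, div_eq_inv_mul _ l]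

theorem continuous_covIntegrand {a : ℝ} (ha : 0 ≤ a) (ha1 : a < 1) (n : ℕ) (s : ℤ) :
    Continuous (covIntegrand n s a) := by
  have hd : ∀ y, vertSymbol a y ^ 2 - (a / 3) ^ 2 ≠ 0 := fun y => by
    have := denom_ge ha ha1 y
    have : 0 < vertSymbol a y ^ 2 - (a / 3) ^ 2 := by linarith
    exact this.ne'
  have := continuous_ratio ha ha1
  exact Continuous.mul (by fun_prop) ((this.pow n).div (by fun_prop) hd)

theorem tendsto_scaled_covKernel {N : ℝ → ℕ} {S : ℝ → ℤ} {τ s δ : ℝ} (hτ : 0 < τ)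
    (hN : Tendsto (fun l => (N l : ℝ) / l) atTop (𝓝 τ))
    (hS : Tendsto (fun l => (S l : ℝ) / √l) atTop (𝓝 s)) (hδ : 0 < δ) :
    Tendsto (fun l : ℝ => l ^ (-(1 / 2) : ℝ) * covKernel (N l) (S l) (1 - δ / l)) atTop
      (𝓝 (limKernel τ s δ)) := by
  have h : Tendsto (fun l : ℝ => ∫ x, (Set.Ioc (-(√l * Real.pi)) (√l * Real.pi)).indicator
        (fun x => l⁻¹ * covIntegrand (N l) (S l) (1 - δ / l) (x / √l)) x) atTop
      (𝓝 (∫ x : ℝ, Real.cos (s * x) *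
        (Real.exp (-(τ * (3 * δ + x ^ 2))) / (2 / 3 * (δ + x ^ 2 / 3))))) := by
    refine tendsto_integral_filter_of_dominated_convergence (fun x =>
      60 * δ⁻¹ * Real.exp (-(3 * (τ / 2) / 100 * δ)) *
        Real.exp (-(3 * (τ / 2) / 100) * x ^ 2)) ?_ ?_ ?_ ?_
    · filter_upwards [eventually_gt_atTop δ] with l hl
      have hl0 : 0 < l := hδ.trans hl
      have h1 : δ / l < 1 := (div_lt_one hl0).2 hl
      have h0 : 0 < δ / l := div_pos hδ hl0
      have := continuous_covIntegrand (a := 1 - δ / l) (by linarith) (by linarith) (N l) (S l)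
      exact (Continuous.aestronglyMeasurable (by fun_prop)).indicator measurableSet_Ioc
    · filter_upwards [eventually_mul_le_natCast hτ hN, eventually_gt_atTop δ] with l hl hl1
      exact ae_of_all _ (indicator_scaled_le (half_pos hτ) hl ⟨hδ, hl1⟩)
    · exact (integrable_exp_neg_mul_sq (by positivity)).const_mul _
    · refine ae_of_all _ fun x => ?_
      refine (tendsto_scaled_covIntegrand hN hS hδ x).congr' ?_
      have hpi := Real.pi_pos
      have h2 : Tendsto (fun l : ℝ => √l * Real.pi) atTop atTop :=
        Real.tendsto_sqrt_atTop.atTop_mul_const hpi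
      filter_upwards [h2.eventually_gt_atTop |x|] with l hl
      rw [Set.indicator_of_mem]
      obtain ⟨h3, h4⟩ := abs_lt.1 hl
      exact ⟨h3, h4.le⟩
  refine (h.const_mul _).congr' ?_
  filter_upwards [eventually_gt_atTop 0] with l hl
  rw [rescale_covKernel _ _ _ hl]

end ScaledKernel

/-! ### Evaluating the limit integral for t ≠ 0 -/

section LimitIntegral

theorem integral_cos_mul_gaussian {w : ℝ} (hw : 0 < w) (s : ℝ) :
    ∫ x : ℝ, Real.cos (s * x) * Real.exp (-w * x ^ 2) =
      √(Real.pi / w) * Real.exp (-(s ^ 2 / 4) / w) := by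
  have h := congrArg Complex.re (fourierIntegral_gaussian (b := (w : ℂ)) (by simpa using hw) (s : ℂ))
  have hint : Integrable fun x : ℝ =>
      Complex.exp (Complex.I * s * x) * Complex.exp (-(w : ℂ) * (x : ℂ) ^ 2) := by
    have h1 : Integrable fun x : ℝ => Complex.exp (-(w : ℂ) * (x : ℂ) ^ 2) :=
      integrable_cexp_neg_mul_sq (by simpa using hw)
    refine h1.bdd_mul (c := 1) (Continuous.aestronglyMeasurable (by fun_prop)) (ae_of_all _ fun x => ?_)
    rw [Complex.norm_exp]
    simp
  have e1 : ∀ x : ℝ, (Complex.exp (Complex.I * s * x) * Complex.exp (-(w : ℂ) * (x : ℂ) ^ 2)).re =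
      Real.cos (s * x) * Real.exp (-w * x ^ 2) := by
    intro x
    have e2 : Complex.exp (-(w : ℂ) * (x : ℂ) ^ 2) = ((Real.exp (-w * x ^ 2) : ℝ) : ℂ) := by
      push_cast; rfl
    have e3 : Complex.I * s * x = ((s * x : ℝ) : ℂ) * Complex.I := by push_cast; ring
    rw [e2, Complex.re_mul_ofReal, e3, Complex.exp_ofReal_mul_I_re]
  have h2 := integral_re hint
  simp only [RCLike.re_eq_complex_re, e1] at h2
  rw [h2, h]
  have e4 : ((Real.pi : ℂ) / (w : ℂ)) ^ (1 / 2 : ℂ) = ((√(Real.pi / w) : ℝ) : ℂ) := by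
    rw [Real.sqrt_eq_rpow, Complex.ofReal_cpow (by positivity)]
    push_cast
    rfl
  have e5 : Complex.exp (-(s : ℂ) ^ 2 / (4 * (w : ℂ))) =
      ((Real.exp (-(s ^ 2 / 4) / w) : ℝ) : ℂ) := by
    push_cast
    congr 1
    have : (w : ℂ) ≠ 0 := by exact_mod_cast hw.ne'
    field_simp
  rw [e4, e5, ← Complex.ofReal_mul, Complex.ofReal_re]

/-- With A = 3δ + x², the quotient exp(-τA)/A is the integral of exp(-wA) over w > τ. The
denominator is (2/9)A, and after Fubini the x-integral is a Gaussian Fourier transform. -/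
theorem limKernel_eq {τ s δ : ℝ} (hτ : 0 < τ) (hδ : 0 < δ) :
    limKernel τ s δ = 9 / (4 * Real.pi) * ∫ w in Set.Ioi τ,
      Real.exp (-(3 * w * δ)) * (√(Real.pi / w) * Real.exp (-(s ^ 2 / 4) / w)) := by
  have h1 : ∀ x : ℝ, Real.cos (s * x) * (Real.exp (-(τ * (3 * δ + x ^ 2))) /
      (2 / 3 * (δ + x ^ 2 / 3))) = 9 / 2 * ∫ w in Set.Ioi τ,
        Real.cos (s * x) * Real.exp (-(3 * δ + x ^ 2) * w) := by
    intro x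
    have hv : 0 < 3 * δ + x ^ 2 := by positivity
    rw [integral_const_mul, integral_exp_mul_Ioi (by linarith), neg_mul, mul_comm τ]
    field_simp
    ring
  have hint : Integrable (Function.uncurry fun x w : ℝ =>
      Real.cos (s * x) * Real.exp (-(3 * δ + x ^ 2) * w))
      (volume.prod (volume.restrict (Set.Ioi τ))) := by
    have hg := (integrable_exp_neg_mul_sq hτ).mul_prod
      (integrableOn_exp_mul_Ioi (a := -(3 * δ)) (by linarith) τ)
    refine hg.mono' (Continuous.aestronglyMeasurable (by unfold Function.uncurry; fun_prop)) ?_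
    have hae : ∀ᵐ p : ℝ × ℝ ∂(volume.prod (volume.restrict (Set.Ioi τ))), p.2 ∈ Set.Ioi τ :=
      Measure.quasiMeasurePreserving_snd.ae (ae_restrict_mem measurableSet_Ioi)
    filter_upwards [hae] with p (hp : τ < p.2)
    rw [Function.uncurry, norm_mul, Real.norm_of_nonneg (Real.exp_pos _).le, ← Real.exp_add]
    refine (mul_le_of_le_one_left (Real.exp_pos _).le (Real.abs_cos_le_one _)).trans
      (Real.exp_le_exp.2 ?_)
    nlinarith [sq_nonneg p.1]
  rw [limKernel]
  simp_rw [h1]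
  rw [integral_const_mul, integral_integral_swap hint, ← mul_assoc]
  have hpi := Real.pi_pos
  congr 1
  · field_simp; norm_num
  · refine setIntegral_congr_fun measurableSet_Ioi fun w (hw : τ < w) => ?_
    rw [← integral_cos_mul_gaussian (hτ.trans hw), ← integral_const_mul]
    congr 1
    ext x
    rw [mul_left_comm, ← Real.exp_add]
    congr 2
    ring

/-- For w > τ one has 3wδ ≥ τδ + wδ, and exp(-wδ) ≤ 1/(wδ). The majorant therefore factors as
δ^(β-1) exp(-τδ) times K w^(-3/2). -/
theorem integrable_rpow_mul_exp_mul {β τ : ℝ} (hβ : 0 < β) (hτ : 0 < τ) {g : ℝ → ℝ}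
    (hg : Measurable g) {K : ℝ} (hgK : ∀ w, τ < w → |g w| ≤ K * w ^ (-(1 / 2) : ℝ)) :
    Integrable (Function.uncurry fun δ w : ℝ => δ ^ β * (Real.exp (-(3 * w * δ)) * g w))
      ((volume.restrict (Set.Ioi 0)).prod (volume.restrict (Set.Ioi τ))) := by
  have h1 : IntegrableOn (fun δ : ℝ => δ ^ (β - 1) * Real.exp (-τ * δ)) (Set.Ioi 0) := by
    simpa using integrableOn_rpow_mul_exp_neg_mul_rpow (p := 1) (s := β - 1) (b := τ)
      (by linarith) one_pos hτ
  have h2 : IntegrableOn (fun w : ℝ => K * w ^ (-(3 / 2) : ℝ)) (Set.Ioi τ) :=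
    (integrableOn_Ioi_rpow_of_lt (by norm_num) hτ).const_mul K
  have hm : Measurable (Function.uncurry fun δ w : ℝ =>
      δ ^ β * (Real.exp (-(3 * w * δ)) * g w)) := by
    unfold Function.uncurry
    fun_prop
  refine (h1.mul_prod h2).mono' hm.aestronglyMeasurable ?_
  have hae1 : ∀ᵐ p : ℝ × ℝ ∂((volume.restrict (Set.Ioi 0)).prod (volume.restrict (Set.Ioi τ))),
      p.1 ∈ Set.Ioi (0 : ℝ) :=
    Measure.quasiMeasurePreserving_fst.ae (ae_restrict_mem measurableSet_Ioi)
  have hae2 : ∀ᵐ p : ℝ × ℝ ∂((volume.restrict (Set.Ioi 0)).prod (volume.restrict (Set.Ioi τ))),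
      p.2 ∈ Set.Ioi τ :=
    Measure.quasiMeasurePreserving_snd.ae (ae_restrict_mem measurableSet_Ioi)
  filter_upwards [hae1, hae2] with p (hδ : 0 < p.1) (hw : τ < p.2)
  obtain ⟨δ, w⟩ := p
  simp only at hδ hw
  have hw0 : 0 < w := hτ.trans hw
  have hp : 0 < δ ^ β := by positivity
  simp only [Function.uncurry]
  rw [norm_mul, norm_mul, Real.norm_of_nonneg hp.le, Real.norm_of_nonneg (Real.exp_pos _).le,
    Real.norm_eq_abs]
  have hexp : Real.exp (-(3 * w * δ)) ≤ Real.exp (-τ * δ) * (w⁻¹ * δ⁻¹) := by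
    have e1 : Real.exp (-(w * δ)) ≤ w⁻¹ * δ⁻¹ := by
      rw [← mul_inv, Real.exp_neg]
      gcongr
      linarith [Real.add_one_le_exp (w * δ)]
    calc Real.exp (-(3 * w * δ)) ≤ Real.exp (-τ * δ + -(w * δ)) := by
          refine Real.exp_le_exp.2 ?_
          nlinarith [mul_pos hw0 hδ]
      _ = Real.exp (-τ * δ) * Real.exp (-(w * δ)) := Real.exp_add _ _
      _ ≤ _ := by gcongr
  have hwr : w ^ (-(3 / 2) : ℝ) = w ^ (-(1 / 2) : ℝ) * w⁻¹ := by
    rw [← Real.rpow_neg_one w, ← Real.rpow_add hw0]; norm_num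
  rw [Real.rpow_sub_one hδ.ne', hwr]
  calc δ ^ β * (Real.exp (-(3 * w * δ)) * |g w|)
      ≤ δ ^ β * ((Real.exp (-τ * δ) * (w⁻¹ * δ⁻¹)) * (K * w ^ (-(1 / 2) : ℝ))) := by
        gcongr
        exact hgK w hw
    _ = _ := by rw [div_eq_mul_inv]; ring

/-- After Fubini, the δ-integral for fixed w is Γ(β+1)(3w)^(-β-1). -/
theorem integral_limKernel {β τ : ℝ} (hβ : 0 < β) (hτ : 0 < τ) (φ₁ s : ℝ) :
    ∫ δ in Set.Ioi 0, φ₁ * δ ^ β * limKernel τ s δ =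
      9 / (4 * Real.pi) * √Real.pi * 3 ^ (-β - 1) * φ₁ * Real.Gamma (β + 1) *
        ∫ w in Set.Ioi τ, w ^ (-β - 3 / 2) * Real.exp (-(s ^ 2 / 4) / w) := by
  set g : ℝ → ℝ := fun w => √(Real.pi / w) * Real.exp (-(s ^ 2 / 4) / w) with hg
  have hgm : Measurable g := by fun_prop
  have hsqrt : ∀ w : ℝ, 0 < w → √(Real.pi / w) = √Real.pi * w ^ (-(1 / 2) : ℝ) := by
    intro w hw
    rw [Real.sqrt_div Real.pi_pos.le, Real.rpow_neg hw.le, ← Real.sqrt_eq_rpow, div_eq_mul_inv]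
  have hgK : ∀ w, τ < w → |g w| ≤ √Real.pi * w ^ (-(1 / 2) : ℝ) := by
    intro w hw
    have hw0 : 0 < w := hτ.trans hw
    rw [← hsqrt w hw0, abs_of_nonneg (by positivity)]
    refine mul_le_of_le_one_right (Real.sqrt_nonneg _) (Real.exp_le_one_iff.2 ?_)
    exact div_nonpos_of_nonpos_of_nonneg (by nlinarith [sq_nonneg s]) hw0.le
  have e1 : ∫ δ in Set.Ioi 0, φ₁ * δ ^ β * limKernel τ s δ =
      φ₁ * (9 / (4 * Real.pi)) * ∫ δ in Set.Ioi 0, ∫ w in Set.Ioi τ,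
        δ ^ β * (Real.exp (-(3 * w * δ)) * g w) := by
    rw [← integral_const_mul]
    refine setIntegral_congr_fun measurableSet_Ioi fun δ (hδ : 0 < δ) => ?_
    rw [limKernel_eq hτ hδ, integral_const_mul]
    ring
  rw [e1, integral_integral_swap (integrable_rpow_mul_exp_mul hβ hτ hgm hgK),
    ← integral_const_mul, ← integral_const_mul]
  refine setIntegral_congr_fun measurableSet_Ioi fun w (hw : τ < w) => ?_
  have hw0 : 0 < w := hτ.trans hw
  have h3 := Real.integral_rpow_mul_exp_neg_mul_Ioi (a := β + 1) (r := 3 * w) (by linarith)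
    (by linarith)
  rw [add_sub_cancel_right] at h3
  simp_rw [← mul_assoc]
  rw [integral_mul_const]
  rw [h3, hg]
  simp only
  rw [hsqrt w hw0, one_div, Real.inv_rpow (by positivity), Real.mul_rpow (by norm_num) hw0.le,
    mul_inv, ← Real.rpow_neg hw0.le, ← Real.rpow_neg (by norm_num)]
  have e2 : w ^ (-β - 3 / 2) = w ^ (-(β + 1)) * w ^ (-(1 / 2) : ℝ) := by
    rw [← Real.rpow_add hw0]; congr 1; ring
  rw [e2, show -(β + 1) = -β - 1 by ring]
  ring

/-- The decreasing substitution y = κ/w maps (τ, ∞) onto (0, κ/τ). -/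
theorem integral_Ioi_rpow_mul_exp_neg_div {β τ κ : ℝ} (hτ : 0 < τ) (hκ : 0 < κ) :
    ∫ w in Set.Ioi τ, w ^ (-β - 3 / 2) * Real.exp (-κ / w) =
      κ ^ (-β - 1 / 2) * lowerGamma (β + 1 / 2) (κ / τ) := by
  have himg : (fun w : ℝ => κ / w) '' Set.Ioi τ = Set.Ioo 0 (κ / τ) := by
    ext y
    constructor
    · rintro ⟨w, hw : τ < w, rfl⟩
      exact ⟨div_pos hκ (hτ.trans hw), div_lt_div_of_pos_left hκ hτ hw⟩
    · rintro ⟨h0, h1⟩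
      refine ⟨κ / y, ?_, by field_simp⟩
      rw [lt_div_iff₀ hτ] at h1
      rw [Set.mem_Ioi, lt_div_iff₀ h0, mul_comm]
      exact h1
  have h := integral_image_eq_integral_abs_deriv_smul (s := Set.Ioi τ) (f := fun w : ℝ => κ / w)
    (f' := fun w => -κ / w ^ 2) measurableSet_Ioi
    (fun w (hw : τ < w) => by
      have h1 := (hasDerivAt_inv (hτ.trans hw).ne').const_mul κ
      have e : -κ / w ^ 2 = κ * -(w ^ 2)⁻¹ := by ring
      rw [e]
      exact h1.hasDerivWithinAt)
    (fun x (hx : τ < x) y (hy : τ < y) hxy => by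
      have hx0 := (hτ.trans hx).ne'
      have hy0 := (hτ.trans hy).ne'
      simp only at hxy
      rw [div_eq_div_iff hx0 hy0] at hxy
      exact (mul_left_cancel₀ hκ.ne' hxy).symm)
    (fun y => y ^ (β + 1 / 2 - 1) * Real.exp (-y))
  rw [himg] at h
  rw [lowerGamma, intervalIntegral.integral_of_le (by positivity), integral_Ioc_eq_integral_Ioo, h,
    ← integral_const_mul]
  refine setIntegral_congr_fun measurableSet_Ioi fun w (hw : τ < w) => ?_
  have hw0 : 0 < w := hτ.trans hw
  simp only [smul_eq_mul]
  rw [abs_div, abs_neg, abs_of_pos hκ, abs_of_pos (by positivity : 0 < w ^ 2),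
    Real.div_rpow hκ.le hw0.le, neg_div]
  have e1 : κ ^ (-β - 1 / 2) * (κ * κ ^ (β + 1 / 2 - 1)) = 1 := by
    rw [mul_comm κ, ← Real.rpow_add_one hκ.ne', ← Real.rpow_add hκ]
    norm_num
  have e2 : w ^ (-β - 3 / 2) = (w ^ 2 * w ^ (β + 1 / 2 - 1))⁻¹ := by
    rw [← Real.rpow_natCast w 2, ← Real.rpow_add hw0, ← Real.rpow_neg hw0.le]
    congr 1
    push_cast
    ring
  rw [e2]
  have hw1 : 0 < w ^ (β + 1 / 2 - 1) := by positivity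
  calc _ = (κ ^ (-β - 1 / 2) * (κ * κ ^ (β + 1 / 2 - 1))) *
        ((w ^ 2 * w ^ (β + 1 / 2 - 1))⁻¹ * Real.exp (-(κ / w))) := by rw [e1, one_mul]
    _ = _ := by field_simp

end LimitIntegral

/-! ### The vertical direction t = 0, through Poisson kernels -/

section ZeroTime

/-- The cosine coefficients of the Poisson kernel. -/
theorem cosCoeff_inv_sub_mul_cos {A b R z : ℝ} (hb : 0 < b) (hbA : b < A) (hR : R = √(A ^ 2 - b ^ 2))
    (hz : z = b / (A + R)) (m : ℕ) :
    cosCoeff (fun y => 1 / (A - b * Real.cos y)) m = z ^ m / R := by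
  have hpos : ∀ y, 0 < A - b * Real.cos y := fun y => by nlinarith [Real.cos_le_one y]
  have hR2 : R ^ 2 = A ^ 2 - b ^ 2 := by rw [hR, Real.sq_sqrt (by nlinarith)]
  have hR0 : 0 < R := by rw [hR]; exact Real.sqrt_pos.2 (by nlinarith)
  have hAR : 0 < A + R := by linarith
  have hz0 : 0 < z := by rw [hz]; positivity
  have hz1 : z < 1 := by rw [hz, div_lt_one hAR]; linarith
  have hc : Continuous fun y => 1 / (A - b * Real.cos y) :=
    continuous_const.div (by fun_prop) fun y => (hpos y).ne'
  set I : ℤ → ℝ := cosCoeff fun y => 1 / (A - b * Real.cos y) with hI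
  have hbz : b = z * (A + R) := by rw [hz]; field_simp
  -- Together with `hbz`, this says that z is the root of b z² - 2Az + b = 0 in (0,1), the
  -- characteristic equation of the recurrence below.
  have hzz : z ^ 2 * (A + R) = A - R := by
    rw [hz]; field_simp; nlinarith
  have hrec : ∀ s : ℤ, A * I s - b / 2 * (I (s - 1) + I (s + 1)) = if s = 0 then 1 else 0 := by
    intro s
    rw [hI, cosCoeff_shift hc, ← cosCoeff_const_mul, ← cosCoeff_const_mul, ← cosCoeff_one,
      sub_eq_add_neg, ← neg_one_mul, ← cosCoeff_const_mul, ← cosCoeff_add (by fun_prop)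
      (by fun_prop)]
    refine cosCoeff_congr (fun y => ?_) s
    have := (hpos y).ne'
    field_simp
    ring
  have hbound : ∀ s, |I s| ≤ (A - b)⁻¹ := by
    refine abs_cosCoeff_le fun y => ?_
    rw [abs_of_pos (by have := hpos y; positivity), one_div]
    have : A - b ≤ A - b * Real.cos y := by nlinarith [Real.cos_le_one y]
    gcongr
  -- The second characteristic root is 1/z, so J_m = I_{m+1} - z I_m satisfies J_m = z J_{m+1}.
  -- Boundedness of I then forces J_m = z^k J_{m+k} → 0, that is, J = 0.
  have hJ : ∀ m : ℕ, I (m + 1) - z * I m = z * (I (m + 2) - z * I (m + 1)) := by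
    intro m
    have h := hrec (m + 1)
    rw [if_neg (by omega), add_sub_cancel_right, show (m : ℤ) + 1 + 1 = m + 2 by ring] at h
    have h2 : (A + R) * (I (m + 1) - z * I m) = (A + R) * (z * (I (m + 2) - z * I (m + 1))) := by
      have e : (A + R) * (z * (I (m + 2) - z * I (m + 1))) =
          z * (A + R) * I (m + 2) - z ^ 2 * (A + R) * I (m + 1) := by ring
      rw [e, hzz, ← hbz]
      have e2 : (A + R) * (I (m + 1) - z * I m) = (A + R) * I (m + 1) - z * (A + R) * I m := by ring
      rw [e2, ← hbz]
      linarith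
    exact mul_left_cancel₀ hAR.ne' h2
  have hJk : ∀ k m : ℕ, I (m + 1) - z * I m = z ^ k * (I (m + k + 1) - z * I (m + k)) := by
    intro k
    induction k with
    | zero => simp
    | succ k ih =>
      intro m
      have h := hJ (m + k)
      push_cast at h ⊢
      rw [ih m, h, pow_succ, show (m : ℤ) + (k + 1) + 1 = m + k + 2 by ring,
        show (m : ℤ) + (k + 1) = m + k + 1 by ring]
      ring
  have hstep : ∀ m : ℕ, I (m + 1) = z * I m := by
    intro m
    have hlim : Tendsto (fun k : ℕ => z ^ k * (2 * (A - b)⁻¹)) atTop (𝓝 0) := by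
      simpa using (tendsto_pow_atTop_nhds_zero_of_lt_one hz0.le hz1).mul_const (2 * (A - b)⁻¹)
    have h0 : |I (m + 1) - z * I m| ≤ 0 := by
      refine ge_of_tendsto' hlim fun k => ?_
      rw [hJk k m, abs_mul, abs_of_pos (by positivity)]
      gcongr
      refine (abs_sub _ _).trans ?_
      rw [abs_mul, abs_of_pos hz0]
      nlinarith [hbound (m + k + 1), hbound (m + k), abs_nonneg (I (m + k))]
    linarith [abs_nonpos_iff.1 h0]
  -- The equation at s = 0 becomes (A - bz) I_0 = 1, and bz = A - R.
  have hI0 : I 0 = 1 / R := by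
    have h := hrec 0
    have e : I (0 - 1) = I (0 + 1) := by
      rw [show (0 : ℤ) - 1 = -(0 + 1) by ring, hI, cosCoeff_neg]
    have h1 := hstep 0
    simp only [Nat.cast_zero] at h1
    rw [if_pos rfl, e, h1] at h
    rw [eq_div_iff hR0.ne']
    have e2 : b * z = A - R := by rw [← hzz, hbz]; ring
    nlinarith
  induction m with
  | zero => simpa using hI0
  | succ m ih =>
    push_cast
    rw [hstep m, ih, pow_succ]
    ring

/-- `(b / (A + R)) ^ k / ((A + R) R)` with `R = √(A² - b²)`. -/
def poissonTerm (A b : ℝ) (k : ℕ) : ℝ :=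
  (b / (A + √(A ^ 2 - b ^ 2))) ^ k / ((A + √(A ^ 2 - b ^ 2)) * √(A ^ 2 - b ^ 2))

/-- The denominator factors as (v - a/3)(v + a/3), and the factors differ by 2a/3, which is also the
coefficient of cos y. Partial fractions thus give two Poisson kernels with the same b; dividing by b
lowers the exponent of z by one, hence the index k + 1. -/
theorem covKernel_zero_succ {a : ℝ} (ha : 0 < a) (ha1 : a < 1) (k : ℕ) :
    covKernel 0 ((k + 1 : ℕ) : ℤ) a =
      poissonTerm (1 - a / 3) (2 * a / 3) k - poissonTerm (1 + a / 3) (2 * a / 3) k := by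
  have hb : 0 < 2 * a / 3 := by positivity
  have h1 : 2 * a / 3 < 1 - a / 3 := by linarith
  have h2 : 2 * a / 3 < 1 + a / 3 := by linarith
  have p1 : ∀ y, 0 < 1 - a / 3 - 2 * a / 3 * Real.cos y := fun y => by
    nlinarith [Real.cos_le_one y]
  have p2 : ∀ y, 0 < 1 + a / 3 - 2 * a / 3 * Real.cos y := fun y => by
    nlinarith [Real.cos_le_one y]
  have c1 : Continuous fun y => 1 / (1 - a / 3 - 2 * a / 3 * Real.cos y) :=
    continuous_const.div (by fun_prop) fun y => (p1 y).ne'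
  have c2 : Continuous fun y => 1 / (1 + a / 3 - 2 * a / 3 * Real.cos y) :=
    continuous_const.div (by fun_prop) fun y => (p2 y).ne'
  have e : covKernel 0 ((k + 1 : ℕ) : ℤ) a = (2 * a / 3)⁻¹ *
      (cosCoeff (fun y => 1 / (1 - a / 3 - 2 * a / 3 * Real.cos y)) ((k + 1 : ℕ) : ℤ) +
        -1 * cosCoeff (fun y => 1 / (1 + a / 3 - 2 * a / 3 * Real.cos y)) ((k + 1 : ℕ) : ℤ)) := by
    rw [← cosCoeff_const_mul, ← cosCoeff_add c1 (by fun_prop), ← cosCoeff_const_mul, covKernel]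
    refine cosCoeff_congr (fun y => ?_) _
    have q1 := (p1 y).ne'
    have q2 := (p2 y).ne'
    have e3 : vertSymbol a y ^ 2 - (a / 3) ^ 2 =
        (1 - a / 3 - 2 * a / 3 * Real.cos y) * (1 + a / 3 - 2 * a / 3 * Real.cos y) := by
      unfold vertSymbol; ring
    have key : ∀ u v b : ℝ, u ≠ 0 → v ≠ 0 → b ≠ 0 → v = u + b →
        1 / (u * v) = b⁻¹ * (1 / u + -1 * (1 / v)) := by
      intro u v b hu hv hb' h
      subst h
      field_simp
      ring
    rw [e3, pow_zero]
    exact key _ _ _ q1 q2 hb.ne' (by ring)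
  have key : ∀ A R : ℝ, (2 * a / 3)⁻¹ * ((2 * a / 3 / A) ^ (k + 1) / R) =
      (2 * a / 3 / A) ^ k / (A * R) := by
    intro A R
    rw [pow_succ]
    generalize (2 * a / 3 / A) ^ k = x
    field_simp
  rw [e, cosCoeff_inv_sub_mul_cos hb h1 rfl rfl, cosCoeff_inv_sub_mul_cos hb h2 rfl rfl,
    poissonTerm, poissonTerm, neg_one_mul, ← sub_eq_add_neg, mul_sub, key, key]

theorem poissonTerm_nonneg {A b : ℝ} (hA : 0 ≤ A) (hb : 0 ≤ b) (k : ℕ) :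
    0 ≤ poissonTerm A b k := by
  unfold poissonTerm; positivity

theorem poissonTerm_le {A b r : ℝ} (hb : 0 ≤ b) (hb' : b ≤ 2 / 3) (hA : 2 / 3 ≤ A) (hr : 0 < r)
    (hr1 : r ≤ 1) (hrR : r ^ 2 ≤ A ^ 2 - b ^ 2) (k : ℕ) :
    poissonTerm A b k ≤ 3 / 2 * r⁻¹ * Real.exp (-(k * r / 3)) := by
  have hR : r ≤ √(A ^ 2 - b ^ 2) := Real.le_sqrt_of_sq_le hrR
  unfold poissonTerm
  set R := √(A ^ 2 - b ^ 2)
  have hz : b / (A + R) ≤ Real.exp (-(r / 3)) := by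
    refine le_trans ?_ (Real.add_one_le_exp _)
    rw [div_le_iff₀ (by linarith)]
    nlinarith
  have hk : (b / (A + R)) ^ k ≤ Real.exp (-(k * r / 3)) := by
    calc (b / (A + R)) ^ k ≤ Real.exp (-(r / 3)) ^ k :=
          pow_le_pow_left₀ (div_nonneg hb (by linarith)) hz k
      _ = _ := by rw [← Real.exp_nat_mul]; congr 1; ring
  calc _ ≤ Real.exp (-(k * r / 3)) / (2 / 3 * r) := by
        gcongr
        linarith
    _ = _ := by field_simp

/-- For both Poisson terms A² - b² ≥ 1 - a, so r = √(1-a) serves in both, and a difference of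
nonnegative numbers is bounded by their common bound. -/
theorem abs_covKernel_zero_le {a : ℝ} (ha : 0 < a) (ha1 : a < 1) (k : ℕ) :
    |covKernel 0 ((k + 1 : ℕ) : ℤ) a| ≤ 3 / 2 * (√(1 - a))⁻¹ * Real.exp (-(k * √(1 - a) / 3)) := by
  have hr : 0 < √(1 - a) := Real.sqrt_pos.2 (by linarith)
  have hr1 : √(1 - a) ≤ 1 := Real.sqrt_le_one.2 (by linarith)
  have hsq : √(1 - a) ^ 2 = 1 - a := Real.sq_sqrt (by linarith)
  rw [covKernel_zero_succ ha ha1]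
  refine abs_sub_le_of_nonneg_of_le (poissonTerm_nonneg (by linarith) (by linarith) k) ?_
    (poissonTerm_nonneg (by linarith) (by linarith) k) ?_
  · exact poissonTerm_le (by linarith) (by linarith) (by linarith) hr hr1 (by nlinarith) k
  · exact poissonTerm_le (by linarith) (by linarith) (by linarith) hr hr1 (by nlinarith) k

theorem covKernel_neg (n : ℕ) (s : ℤ) (a : ℝ) : covKernel n (-s) a = covKernel n s a :=
  cosCoeff_neg _ s

theorem covKernel_natAbs (n : ℕ) (s : ℤ) (a : ℝ) : covKernel n (s.natAbs : ℤ) a = covKernel n s a := by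
  rcases Int.natAbs_eq s with h | h
  · rw [← h]
  · conv_rhs => rw [h, covKernel_neg]

theorem covKernel_of_natAbs_pos (n : ℕ) {s : ℤ} (hs : 1 ≤ s.natAbs) (a : ℝ) :
    covKernel n s a = covKernel n ((s.natAbs - 1 + 1 : ℕ) : ℤ) a := by
  rw [Nat.sub_add_cancel hs, covKernel_natAbs]

/-- Since s ≠ 0, |S l| is eventually at least 1, so the truncated subtraction is genuine and the
shift by one disappears after division by √l. -/
theorem tendsto_natAbs_sub_one_div_sqrt {S : ℝ → ℤ} {s : ℝ} (hs : s ≠ 0)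
    (hS : Tendsto (fun l => (S l : ℝ) / √l) atTop (𝓝 s)) :
    (∀ᶠ l in atTop, 1 ≤ (S l).natAbs) ∧
      Tendsto (fun l => (((S l).natAbs - 1 : ℕ) : ℝ) / √l) atTop (𝓝 |s|) := by
  have h1 : ∀ᶠ l in atTop, 1 ≤ (S l).natAbs := by
    filter_upwards [hS.eventually_ne hs] with l hl
    rw [Nat.one_le_iff_ne_zero, Int.natAbs_ne_zero]
    intro h0
    simp [h0] at hl
  refine ⟨h1, ?_⟩
  have h2 : Tendsto (fun l : ℝ => 1 / √l) atTop (𝓝 0) :=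
    tendsto_const_nhds.div_atTop Real.tendsto_sqrt_atTop
  have h3 := hS.abs.sub h2
  rw [sub_zero] at h3
  refine h3.congr' ?_
  filter_upwards [h1] with l hl
  rw [Nat.cast_sub hl, Nat.cast_natAbs, abs_div, abs_of_nonneg (Real.sqrt_nonneg l), Nat.cast_one,
    Int.cast_abs, sub_div]

/-- The scaled majorant now decays like exp(-c√δ): k √(1-a) is k√(δ/l), with k eventually at least
|s|√l/2. -/
theorem abs_scaled_covKernel_zero_le {S : ℝ → ℤ} {s : ℝ} (hs : s ≠ 0)
    (hS : Tendsto (fun l => (S l : ℝ) / √l) atTop (𝓝 s)) :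
    ∀ᶠ l : ℝ in atTop, ∀ δ ∈ Set.Ioo 0 l,
      |l ^ (-(1 / 2) : ℝ) * covKernel 0 (S l) (1 - δ / l)| ≤
        3 / 2 * (δ ^ (-(1 / 2) : ℝ) * Real.exp (-(|s| / 6) * δ ^ (1 / 2 : ℝ))) := by
  obtain ⟨h1, h2⟩ := tendsto_natAbs_sub_one_div_sqrt hs hS
  have hs0 : 0 < |s| := abs_pos.2 hs
  filter_upwards [h1, h2.eventually (lt_mem_nhds (half_lt_self hs0)), eventually_gt_atTop 0]
    with l hl1 hl2 hl δ hδ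
  have hδ0 := hδ.1
  have h3 : δ / l < 1 := (div_lt_one hl).2 hδ.2
  have h4 : 0 < δ / l := div_pos hδ0 hl
  have hsl : 0 < √l := Real.sqrt_pos.2 hl
  have h := abs_covKernel_zero_le (a := 1 - δ / l) (by linarith) (by linarith) ((S l).natAbs - 1)
  rw [sub_sub_cancel, Real.sqrt_div hδ0.le] at h
  rw [covKernel_of_natAbs_pos 0 hl1, abs_mul, abs_of_pos (by positivity), Real.rpow_neg hl.le,
    Real.rpow_neg hδ0.le, ← Real.sqrt_eq_rpow, ← Real.sqrt_eq_rpow]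
  have hsδ : 0 < √δ := Real.sqrt_pos.2 hδ0
  set k : ℝ := (((S l).natAbs - 1 : ℕ) : ℝ) with hk
  calc _ ≤ (√l)⁻¹ * (3 / 2 * (√δ / √l)⁻¹ * Real.exp (-(k * (√δ / √l) / 3))) := by gcongr
    _ = 3 / 2 * ((√δ)⁻¹ * Real.exp (-(k / √l * √δ / 3))) := by field_simp
    _ ≤ _ := by
      gcongr
      nlinarith

theorem tendsto_sqrt_mul_log_one_add {g : ℝ → ℝ} {t : ℝ}
    (hg : Tendsto (fun l => √l * g l) atTop (𝓝 t)) :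
    Tendsto (fun l => √l * Real.log (1 + g l)) atTop (𝓝 t) := by
  have h1 : Tendsto (fun v : ℝ => v * g (v ^ 2)) atTop (𝓝 t) := by
    refine (hg.comp (tendsto_pow_atTop two_ne_zero)).congr' ?_
    filter_upwards [eventually_ge_atTop 0] with v hv
    simp only [Function.comp_apply, Real.sqrt_sq hv]
  refine ((Real.tendsto_mul_log_one_add_of_tendsto h1).comp Real.tendsto_sqrt_atTop).congr' ?_
  filter_upwards [eventually_ge_atTop 0] with l hl
  simp only [Function.comp_apply, Real.sq_sqrt hl]

/-- In the first Poisson term A² - b² is of order 1/l, so √l R tends to √(4δ/3) and z^k to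
exp(-|s|√(4δ/3)/(2/3)) = exp(-|s|√(3δ)). -/
theorem tendsto_scaled_covKernel_zero {S : ℝ → ℤ} {s δ : ℝ} (hs : s ≠ 0)
    (hS : Tendsto (fun l => (S l : ℝ) / √l) atTop (𝓝 s)) (hδ : 0 < δ) :
    Tendsto (fun l : ℝ => l ^ (-(1 / 2) : ℝ) * covKernel 0 (S l) (1 - δ / l)) atTop
      (𝓝 (Real.exp (-(|s| * √(3 * δ))) / (2 / 3 * √(4 / 3 * δ)))) := by
  obtain ⟨h1, h2⟩ := tendsto_natAbs_sub_one_div_sqrt hs hS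
  have hδl : Tendsto (fun l : ℝ => δ / l) atTop (𝓝 0) := tendsto_const_nhds.div_atTop tendsto_id
  have ha : Tendsto (fun l : ℝ => 1 - δ / l) atTop (𝓝 1) := by
    simpa using (tendsto_const_nhds (x := (1 : ℝ))).sub hδl
  set R : ℝ → ℝ := fun l => √((1 - (1 - δ / l) / 3) ^ 2 - (2 * (1 - δ / l) / 3) ^ 2) with hRdef
  have hRl : ∀ᶠ l : ℝ in atTop, √l * R l = √(δ * (1 + (1 - δ / l) / 3)) := by
    filter_upwards [eventually_gt_atTop 0] with l hl
    rw [hRdef, ← Real.sqrt_mul hl.le]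
    congr 1
    field_simp
    ring
  have hlR : Tendsto (fun l : ℝ => √l * R l) atTop (𝓝 (√(4 / 3 * δ))) := by
    have h := (Real.continuous_sqrt.tendsto _).comp (((ha.div_const 3).const_add 1).const_mul δ)
    rw [show δ * (1 + 1 / 3) = 4 / 3 * δ by ring] at h
    refine h.congr' ?_
    filter_upwards [hRl] with l hl
    rw [hl, Function.comp_apply]
  have hR : Tendsto R atTop (𝓝 0) := by
    have h := hlR.div_atTop Real.tendsto_sqrt_atTop
    refine h.congr' ?_
    filter_upwards [eventually_gt_atTop 0] with l hl
    have := Real.sqrt_pos.2 hl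
    field_simp
  have hAR : Tendsto (fun l : ℝ => 1 - (1 - δ / l) / 3 + R l) atTop (𝓝 (2 / 3)) := by
    have h := ((ha.div_const 3).const_sub 1).add hR
    rwa [show (1 : ℝ) - 1 / 3 + 0 = 2 / 3 by norm_num] at h
  have hlδ : Tendsto (fun l : ℝ => √l * (δ / l)) atTop (𝓝 0) := by
    have h : Tendsto (fun l : ℝ => δ / √l) atTop (𝓝 0) :=
      tendsto_const_nhds.div_atTop Real.tendsto_sqrt_atTop
    refine h.congr' ?_
    filter_upwards [eventually_gt_atTop 0] with l hl
    have h3 := Real.sqrt_pos.2 hl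
    nth_rw 3 [← Real.sq_sqrt hl.le]
    field_simp
  have hsqrt3 : √(4 / 3 * δ) / (2 / 3) = √(3 * δ) := by
    rw [div_eq_iff (by norm_num), show 4 / 3 * δ = 3 * δ * (2 / 3) ^ 2 by ring,
      Real.sqrt_mul (by positivity), Real.sqrt_sq (by norm_num)]
  have hlog : Tendsto (fun l : ℝ => √l * Real.log (1 + -((δ / l + R l) /
      (1 - (1 - δ / l) / 3 + R l)))) atTop (𝓝 (-√(3 * δ))) := by
    apply tendsto_sqrt_mul_log_one_add
    have h := ((hlδ.add hlR).div hAR (by norm_num)).neg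
    rw [zero_add, hsqrt3] at h
    refine h.congr fun l => ?_
    simp only [Pi.div_apply]
    ring
  have hpow : Tendsto (fun l : ℝ => (2 * (1 - δ / l) / 3 / (1 - (1 - δ / l) / 3 + R l)) ^
      ((S l).natAbs - 1)) atTop (𝓝 (Real.exp (-(|s| * √(3 * δ))))) := by
    have h := (Real.continuous_exp.tendsto _).comp (h2.mul hlog)
    rw [mul_neg] at h
    refine h.congr' ?_
    filter_upwards [eventually_gt_atTop δ] with l hl
    have hl0 : 0 < l := hδ.trans hl
    have h3 : δ / l < 1 := (div_lt_one hl0).2 hl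
    have h4 : 0 < δ / l := div_pos hδ hl0
    have hR0 : 0 ≤ R l := Real.sqrt_nonneg _
    have hp : 0 < 1 - (1 - δ / l) / 3 + R l := by linarith
    have e : 1 + -((δ / l + R l) / (1 - (1 - δ / l) / 3 + R l)) =
        2 * (1 - δ / l) / 3 / (1 - (1 - δ / l) / 3 + R l) := by
      rw [eq_div_iff hp.ne', add_mul, neg_mul, div_mul_cancel₀ _ hp.ne']
      ring
    have hpos : 0 < 2 * (1 - δ / l) / 3 / (1 - (1 - δ / l) / 3 + R l) :=
      div_pos (by linarith) hp
    rw [Function.comp_apply, e, ← mul_assoc, div_mul_cancel₀ _ (Real.sqrt_pos.2 hl0).ne',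
      Real.exp_nat_mul, Real.exp_log hpos]
  have hfirst : Tendsto (fun l : ℝ => l ^ (-(1 / 2) : ℝ) *
      poissonTerm (1 - (1 - δ / l) / 3) (2 * (1 - δ / l) / 3) ((S l).natAbs - 1)) atTop
      (𝓝 (Real.exp (-(|s| * √(3 * δ))) / (2 / 3 * √(4 / 3 * δ)))) := by
    refine (hpow.div (hAR.mul hlR) (by positivity)).congr' ?_
    filter_upwards [eventually_gt_atTop 0] with l hl
    rw [poissonTerm, Real.rpow_neg hl.le, ← Real.sqrt_eq_rpow, Pi.div_apply]
    change _ / (_ * (√l * R l)) = (√l)⁻¹ * (_ / (_ * R l))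
    rw [mul_left_comm, ← div_div _ (√l), div_right_comm, ← div_eq_inv_mul]
  -- In the second term R stays above 1/2, so the term is at most 3 and the prefactor l^(-1/2) makes
  -- it vanish.
  have hsecond : Tendsto (fun l : ℝ => l ^ (-(1 / 2) : ℝ) *
      poissonTerm (1 + (1 - δ / l) / 3) (2 * (1 - δ / l) / 3) ((S l).natAbs - 1)) atTop (𝓝 0) := by
    have hz : Tendsto (fun l : ℝ => l ^ (-(1 / 2) : ℝ) * 3) atTop (𝓝 0) := by
      simpa using (tendsto_rpow_neg_atTop (y := 1 / 2) (by norm_num)).mul_const 3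
    refine tendsto_of_tendsto_of_tendsto_of_le_of_le' tendsto_const_nhds hz ?_ ?_
    · filter_upwards [eventually_gt_atTop δ] with l hl
      have hl0 : 0 < l := hδ.trans hl
      have h3 : δ / l < 1 := (div_lt_one hl0).2 hl
      exact mul_nonneg (by positivity) (poissonTerm_nonneg (by linarith) (by linarith) _)
    · filter_upwards [eventually_gt_atTop δ] with l hl
      have hl0 : 0 < l := hδ.trans hl
      have h3 : δ / l < 1 := (div_lt_one hl0).2 hl
      have h4 : 0 < δ / l := div_pos hδ hl0
      have h5 := poissonTerm_le (A := 1 + (1 - δ / l) / 3) (b := 2 * (1 - δ / l) / 3)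
        (r := 1 / 2) (by linarith) (by linarith) (by linarith) (by norm_num) (by norm_num)
        (by nlinarith) ((S l).natAbs - 1)
      have h6 : Real.exp (-((((S l).natAbs - 1 : ℕ) : ℝ) * (1 / 2) / 3)) ≤ 1 :=
        Real.exp_le_one_iff.2 (by rw [neg_nonpos]; positivity)
      gcongr
      linarith
  have h := hfirst.sub hsecond
  rw [sub_zero] at h
  refine h.congr' ?_
  filter_upwards [h1, eventually_gt_atTop δ] with l hl1 hl
  have hl0 : 0 < l := hδ.trans hl
  have h3 : δ / l < 1 := (div_lt_one hl0).2 hl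
  have h4 : 0 < δ / l := div_pos hδ hl0
  rw [covKernel_of_natAbs_pos 0 hl1, covKernel_zero_succ (by linarith) (by linarith)]
  exact (mul_sub _ _ _).symm

theorem integral_limKernel_zero {β s : ℝ} (hβ : 0 < β) (hs : s ≠ 0) (φ₁ : ℝ) :
    ∫ δ in Set.Ioi 0, φ₁ * δ ^ β * (Real.exp (-(|s| * √(3 * δ))) / (2 / 3 * √(4 / 3 * δ))) =
      φ₁ * (3 * √3 / 2) * (√3 * |s|) ^ (-(2 * β + 1)) * Real.Gamma (2 * β + 1) := by
  have hs0 : 0 < |s| := abs_pos.2 hs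
  have h := integral_rpow_mul_exp_neg_mul_rpow (p := 1 / 2) (q := β - 1 / 2) (b := √3 * |s|)
    (by norm_num) (by linarith) (by positivity)
  rw [show -(β - 1 / 2 + 1) / (1 / 2) = -(2 * β + 1) by ring,
    show (β - 1 / 2 + 1) / (1 / 2) = 2 * β + 1 by ring, show (1 : ℝ) / (1 / 2) = 2 by norm_num] at h
  have e : ∫ δ in Set.Ioi 0, φ₁ * δ ^ β *
      (Real.exp (-(|s| * √(3 * δ))) / (2 / 3 * √(4 / 3 * δ))) =
      φ₁ * (3 * √3 / 4) * ∫ δ in Set.Ioi 0,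
        δ ^ (β - 1 / 2) * Real.exp (-(√3 * |s|) * δ ^ (1 / 2 : ℝ)) := by
    rw [← integral_const_mul]
    refine setIntegral_congr_fun measurableSet_Ioi fun δ (hδ : 0 < δ) => ?_
    have h3 : (0 : ℝ) < √3 := by positivity
    have hsδ : 0 < √δ := Real.sqrt_pos.2 hδ
    have h4 : √(4 / 3 * δ) = 2 / √3 * √δ := by
      rw [Real.sqrt_mul (by norm_num), Real.sqrt_div (by norm_num),
        show (4 : ℝ) = 2 ^ 2 by norm_num, Real.sqrt_sq (by norm_num)]
    rw [h4, Real.sqrt_mul (by norm_num), Real.rpow_sub hδ, ← Real.sqrt_eq_rpow,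
      show -(|s| * (√3 * √δ)) = -(√3 * |s|) * √δ by ring]
    field_simp
    norm_num
  rw [e, h]
  ring

end ZeroTime

/-! ### Limits of the covariance and identification of the constants -/

section CovarianceLimit

theorem tendsto_floor_mul_div (t : ℝ) :
    Tendsto (fun l : ℝ => (⌊l * t⌋ : ℝ) / l) atTop (𝓝 t) := by
  have h1 : Tendsto (fun l : ℝ => t - 1 / l) atTop (𝓝 t) := by
    simpa using (tendsto_const_nhds (x := t)).sub
      ((tendsto_const_nhds (x := (1 : ℝ))).div_atTop tendsto_id)
  refine tendsto_of_tendsto_of_tendsto_of_le_of_le' h1 tendsto_const_nhds ?_ ?_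
  · filter_upwards [eventually_gt_atTop 0] with l hl
    rw [le_div_iff₀ hl, sub_mul, div_mul_cancel₀ _ hl.ne', mul_comm]
    exact (Int.sub_one_lt_floor _).le
  · filter_upwards [eventually_gt_atTop 0] with l hl
    rw [div_le_iff₀ hl, mul_comm t]
    exact Int.floor_le _

variable {φ : ℝ → ℝ} {σ β φ₁ C : ℝ} {Ω : Type*} [MeasurableSpace Ω] {P : Measure Ω}
  [IsProbabilityMeasure P] {M : Set ((ℤ × ℤ) × ℝ) → Ω → ℝ}

/-- Only t ≠ 0 is needed for the decay, so s = 0 is allowed: this serves both the generic and the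
horizontal case. -/
theorem tendsto_covFun_of_ne_zero (hM : IsGaussianRandomMeasure P (controlMeasure σ φ) M)
    (hφm : Measurable φ) (hφ0 : ∀ a ∈ Set.Ico (0 : ℝ) 1, 0 ≤ φ a) (hβ : 0 < β) (hφ₁ : 0 < φ₁)
    (hφb : ∀ a ∈ Set.Ico (0 : ℝ) 1, φ a ≤ C * (1 - a) ^ β)
    (hφasy : φ ~[𝓝[<] 1] fun a => φ₁ * (1 - a) ^ β) {X : ℤ × ℤ → Ω → ℝ}
    (hX : IsAggregatedField P σ φ M X) {t s : ℝ} (ht : t ≠ 0) {S : ℝ → ℤ}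
    (hS : Tendsto (fun l => (S l : ℝ) / √l) atTop (𝓝 s)) :
    Tendsto (fun l : ℝ => l ^ (β + 1 / 2) * covFun P X ⌊l * t⌋ (S l)) atTop
      (𝓝 (σ ^ 2 * (9 / (4 * Real.pi) * √Real.pi * 3 ^ (-β - 1) * φ₁ * Real.Gamma (β + 1) *
        ∫ w in Set.Ioi |t|, w ^ (-β - 3 / 2) * Real.exp (-(s ^ 2 / 4) / w)))) := by
  have ht0 : 0 < |t| := abs_pos.2 ht
  have hN : Tendsto (fun l : ℝ => ((⌊l * t⌋.natAbs : ℕ) : ℝ) / l) atTop (𝓝 |t|) := by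
    refine (tendsto_floor_mul_div t).abs.congr' ?_
    filter_upwards [eventually_ge_atTop 0] with l hl
    rw [Nat.cast_natAbs, Int.cast_abs, abs_div, abs_of_nonneg hl]
  rw [← integral_limKernel hβ ht0]
  have h := (tendsto_mixture (C := C) hφm hφ0 hφ₁ hφb hφasy
    (k := fun l => covKernel ⌊l * t⌋.natAbs (S l)) (fun l => measurable_covKernel _ _)
    (abs_scaled_covKernel_le ht0 hN) ?_
    (fun δ hδ => tendsto_scaled_covKernel ht0 hN hS hδ)).const_mul (σ ^ 2)
  · refine h.congr fun l => ?_
    rw [covFun_eq hM hφm hφ0 hβ hφb hX]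
    ring
  · have h1 : IntegrableOn (fun δ : ℝ => δ ^ (β - 1) *
        Real.exp (-(3 * (|t| / 2) / 100) * δ ^ (1 : ℝ))) (Set.Ioi 0) :=
      integrableOn_rpow_mul_exp_neg_mul_rpow (by linarith) one_pos (by positivity)
    refine (h1.const_mul ((2 * Real.pi)⁻¹ *
      (∫ x : ℝ, Real.exp (-(3 * (|t| / 2) / 100) * x ^ 2)) * 60)).congr ?_
    filter_upwards [ae_restrict_mem measurableSet_Ioi] with δ (hδ : 0 < δ)
    rw [Real.rpow_sub_one hδ.ne', Real.rpow_one, neg_mul]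
    ring

theorem tendsto_covFun_zero (hM : IsGaussianRandomMeasure P (controlMeasure σ φ) M)
    (hφm : Measurable φ) (hφ0 : ∀ a ∈ Set.Ico (0 : ℝ) 1, 0 ≤ φ a) (hβ : 0 < β) (hφ₁ : 0 < φ₁)
    (hφb : ∀ a ∈ Set.Ico (0 : ℝ) 1, φ a ≤ C * (1 - a) ^ β)
    (hφasy : φ ~[𝓝[<] 1] fun a => φ₁ * (1 - a) ^ β) {X : ℤ × ℤ → Ω → ℝ}
    (hX : IsAggregatedField P σ φ M X) {s : ℝ} (hs : s ≠ 0) {S : ℝ → ℤ}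
    (hS : Tendsto (fun l => (S l : ℝ) / √l) atTop (𝓝 s)) :
    Tendsto (fun l : ℝ => l ^ (β + 1 / 2) * covFun P X 0 (S l)) atTop
      (𝓝 (σ ^ 2 * (φ₁ * (3 * √3 / 2) * (√3 * |s|) ^ (-(2 * β + 1)) *
        Real.Gamma (2 * β + 1)))) := by
  rw [← integral_limKernel_zero hβ hs]
  have hs0 : 0 < |s| := abs_pos.2 hs
  have h := (tendsto_mixture (C := C) hφm hφ0 hφ₁ hφb hφasy
    (k := fun l => covKernel 0 (S l)) (fun l => measurable_covKernel _ _)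
    (abs_scaled_covKernel_zero_le hs hS) ?_
    (fun δ hδ => tendsto_scaled_covKernel_zero hs hS hδ)).const_mul (σ ^ 2)
  · refine h.congr fun l => ?_
    rw [covFun_eq hM hφm hφ0 hβ hφb hX, Int.natAbs_zero]
    ring
  · have h1 : IntegrableOn (fun δ : ℝ => δ ^ (β - 1 / 2) *
        Real.exp (-(|s| / 6) * δ ^ (1 / 2 : ℝ))) (Set.Ioi 0) :=
      integrableOn_rpow_mul_exp_neg_mul_rpow (by linarith) (by norm_num) (by positivity)
    refine (h1.const_mul (3 / 2)).congr ?_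
    filter_upwards [ae_restrict_mem measurableSet_Ioi] with δ (hδ : 0 < δ)
    rw [sub_eq_add_neg, Real.rpow_add hδ]
    ring

theorem sq_div_four_rpow {s : ℝ} (hs : s ≠ 0) (β : ℝ) :
    (s ^ 2 / 4) ^ (-β - 1 / 2) = |s| ^ (-2 * β - 1) * 2 ^ (2 * β + 1) := by
  have hs0 : 0 < |s| := abs_pos.2 hs
  rw [show s ^ 2 / 4 = (|s| / 2) ^ (2 : ℝ) by rw [Real.rpow_two, div_pow, sq_abs]; norm_num,
    ← Real.rpow_mul (by positivity), show 2 * (-β - 1 / 2) = -2 * β - 1 by ring,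
    Real.div_rpow hs0.le (by norm_num), div_eq_mul_inv, ← Real.rpow_neg (by norm_num)]
  congr 2
  ring

theorem constC3_eq (β φ₁ σ : ℝ) : constC3 β φ₁ σ =
    σ ^ 2 * (9 / (4 * Real.pi) * √Real.pi * 3 ^ (-β - 1) * φ₁ * Real.Gamma (β + 1)) *
      2 ^ (2 * β + 1) := by
  have hpi := Real.pi_pos
  have e1 : (2 : ℝ) ^ (2 * β + 1) = 4 * 2 ^ (2 * β - 1) := by
    rw [show 2 * β + 1 = 2 + (2 * β - 1) by ring, Real.rpow_add two_pos, Real.rpow_two]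
    norm_num
  have e2 : (3 : ℝ) ^ (1 - β) = 9 * 3 ^ (-β - 1) := by
    rw [show 1 - β = 2 + (-β - 1) by ring, Real.rpow_add three_pos, Real.rpow_two]
    norm_num
  have e3 : Real.pi ^ (-(1 / 2) : ℝ) = √Real.pi / Real.pi := by
    rw [Real.rpow_neg hpi.le, ← Real.sqrt_eq_rpow, Real.sqrt_div_self']
    simp
  rw [constC3, e1, e2, e3]
  field_simp

theorem limit_const_generic (φ₁ σ : ℝ) {β t s : ℝ} (ht : t ≠ 0) (hs : s ≠ 0) :
    σ ^ 2 * (9 / (4 * Real.pi) * √Real.pi * 3 ^ (-β - 1) * φ₁ * Real.Gamma (β + 1) *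
        ∫ w in Set.Ioi |t|, w ^ (-β - 3 / 2) * Real.exp (-(s ^ 2 / 4) / w)) =
      constC3 β φ₁ σ * |s| ^ (-2 * β - 1) * lowerGamma (β + 1 / 2) (s ^ 2 / (4 * |t|)) := by
  rw [integral_Ioi_rpow_mul_exp_neg_div (abs_pos.2 ht) (by positivity), sq_div_four_rpow hs,
    constC3_eq, div_div]
  ring

theorem limit_const_horizontal (φ₁ σ : ℝ) {β t : ℝ} (hβ : 0 < β) (ht : t ≠ 0) :
    σ ^ 2 * (9 / (4 * Real.pi) * √Real.pi * 3 ^ (-β - 1) * φ₁ * Real.Gamma (β + 1) *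
        ∫ w in Set.Ioi |t|, w ^ (-β - 3 / 2) * Real.exp (-((0 : ℝ) ^ 2 / 4) / w)) =
      constC4 β φ₁ σ * |t| ^ (-β - 1 / 2) := by
  have e : ∫ w in Set.Ioi |t|, w ^ (-β - 3 / 2) * Real.exp (-((0 : ℝ) ^ 2 / 4) / w) =
      |t| ^ (-β - 1 / 2) * (1 / 2 + β)⁻¹ := by
    have h := integral_Ioi_rpow_of_lt (a := -β - 3 / 2) (by linarith) (abs_pos.2 ht)
    simp only [ne_eq, OfNat.ofNat_ne_zero, not_false_eq_true, zero_pow, zero_div, neg_zero,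
      Real.exp_zero, mul_one]
    rw [h, show -β - 3 / 2 + 1 = -(1 / 2 + β) by ring, neg_div_neg_eq,
      show -(1 / 2 + β) = -β - 1 / 2 by ring, div_eq_mul_inv]
  have e2 : (4 : ℝ) ^ (-(1 / 2) - β) * 2 ^ (2 * β + 1) = 1 := by
    rw [show (4 : ℝ) = 2 ^ (2 : ℝ) by rw [Real.rpow_two]; norm_num, ← Real.rpow_mul (by norm_num),
      ← Real.rpow_add two_pos, show 2 * (-(1 / 2) - β) + (2 * β + 1) = 0 by ring, Real.rpow_zero]
  rw [e, constC4, constC3_eq]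
  linear_combination (-(1 / 2 + β)⁻¹ * (σ ^ 2 * (9 / (4 * Real.pi) * √Real.pi * 3 ^ (-β - 1) * φ₁ *
    Real.Gamma (β + 1))) * |t| ^ (-β - 1 / 2)) * e2

/-- Legendre's duplication formula at β + 1/2 converts Γ(2β+1) into the product of gamma functions
hidden in C₃ Γ(β+1/2). -/
theorem limit_const_vertical (φ₁ σ : ℝ) {β s : ℝ} (hs : s ≠ 0) :
    σ ^ 2 * (φ₁ * (3 * √3 / 2) * (√3 * |s|) ^ (-(2 * β + 1)) * Real.Gamma (2 * β + 1)) =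
      constC3 β φ₁ σ * |s| ^ (-2 * β - 1) * Real.Gamma (β + 1 / 2) := by
  have hs0 : 0 < |s| := abs_pos.2 hs
  have hdup := Real.Gamma_mul_Gamma_add_half (β + 1 / 2)
  rw [show β + 1 / 2 + 1 / 2 = β + 1 by ring, show 2 * (β + 1 / 2) = 2 * β + 1 by ring,
    show 1 - (2 * β + 1) = -(2 * β) by ring] at hdup
  have e1 : Real.pi ^ (-(1 / 2) : ℝ) * √Real.pi = 1 := by
    rw [Real.sqrt_eq_rpow, ← Real.rpow_add Real.pi_pos]; norm_num
  have e2 : (2 : ℝ) ^ (2 * β - 1) * 2 ^ (-(2 * β)) = 1 / 2 := by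
    rw [← Real.rpow_add two_pos, show 2 * β - 1 + -(2 * β) = -1 by ring, Real.rpow_neg_one]
    norm_num
  have e3 : (3 : ℝ) ^ (1 - β) = 3 * √3 * √3 ^ (-(2 * β + 1)) := by
    rw [Real.sqrt_eq_rpow, ← Real.rpow_mul (by norm_num), mul_assoc, ← Real.rpow_add three_pos,
      mul_comm, ← Real.rpow_add_one (by norm_num)]
    congr 1
    ring
  rw [Real.mul_rpow (by positivity) hs0.le, show -(2 * β + 1) = -2 * β - 1 by ring, constC3]
  rw [show -(2 * β + 1) = -2 * β - 1 by ring] at e3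
  calc _ = σ ^ 2 * φ₁ * |s| ^ (-2 * β - 1) * (3 * √3 * √3 ^ (-2 * β - 1)) * (1 / 2) * 1 *
        Real.Gamma (2 * β + 1) := by ring
    _ = σ ^ 2 * φ₁ * |s| ^ (-2 * β - 1) * 3 ^ (1 - β) * (2 ^ (2 * β - 1) * 2 ^ (-(2 * β))) *
        (Real.pi ^ (-(1 / 2) : ℝ) * √Real.pi) * Real.Gamma (2 * β + 1) := by rw [e1, e2, e3]
    _ = σ ^ 2 * φ₁ * |s| ^ (-2 * β - 1) * 3 ^ (1 - β) * 2 ^ (2 * β - 1) *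
        Real.pi ^ (-(1 / 2) : ℝ) * (Real.Gamma (2 * β + 1) * 2 ^ (-(2 * β)) * √Real.pi) := by ring
    _ = _ := by rw [← hdup]; ring

theorem covFun_natAbs_zero (hM : IsGaussianRandomMeasure P (controlMeasure σ φ) M)
    (hφm : Measurable φ) (hφ0 : ∀ a ∈ Set.Ico (0 : ℝ) 1, 0 ≤ φ a) (hβ : 0 < β)
    (hφb : ∀ a ∈ Set.Ico (0 : ℝ) 1, φ a ≤ C * (1 - a) ^ β) {X : ℤ × ℤ → Ω → ℝ}
    (hX : IsAggregatedField P σ φ M X) (t : ℤ) :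
    covFun P X t.natAbs 0 = covFun P X t 0 := by
  rw [covFun_eq hM hφm hφ0 hβ hφb hX, covFun_eq hM hφm hφ0 hβ hφb hX, Int.natAbs_natCast]

/-- The real limit is sampled at l = |t|, which tends to infinity along the cofinite filter on ℤ;
evenness of r recovers negative t. -/
theorem isEquivalent_of_tendsto_rpow_mul {r : ℤ → ℝ} {β c : ℝ} (hc : c ≠ 0)
    (hr : ∀ t : ℤ, r t.natAbs = r t)
    (h : Tendsto (fun l : ℝ => l ^ (β + 1 / 2) * r ⌊l * 1⌋) atTop (𝓝 c)) :
    r ~[cofinite] fun t : ℤ => c * |(t : ℝ)| ^ (-β - 1 / 2) := by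
  have hfib : ∀ n : ℕ, (Int.natAbs ⁻¹' {n}).Finite := fun n =>
    (Set.toFinite {(n : ℤ), -(n : ℤ)}).subset fun t (ht : t.natAbs = n) => by
      rcases Int.natAbs_eq t with h | h <;> rw [ht] at h <;> simp [h]
  have habs : Tendsto Int.natAbs cofinite atTop := by
    rw [← Nat.cofinite_eq_atTop]
    exact .cofinite_of_finite_preimage_singleton hfib
  have h1 := (h.comp tendsto_natCast_atTop_atTop).comp habs
  have h2 : Tendsto (fun t : ℤ => |(t : ℝ)| ^ (β + 1 / 2) * r t) cofinite (𝓝 c) := by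
    refine h1.congr fun t => ?_
    simp only [Function.comp_apply, mul_one, Int.floor_natCast]
    rw [hr, Nat.cast_natAbs, Int.cast_abs]
  refine (((isEquivalent_const_iff_tendsto hc).2 h2).mul
    (IsEquivalent.refl (u := fun t : ℤ => |(t : ℝ)| ^ (-β - 1 / 2)))).congr_left ?_
  filter_upwards [(Set.finite_singleton (0 : ℤ)).compl_mem_cofinite] with t ht
  have ht0 : 0 < |(t : ℝ)| := abs_pos.2 (by exact_mod_cast ht)
  rw [Pi.mul_apply, mul_right_comm, ← Real.rpow_add ht0,
    show β + 1 / 2 + (-β - 1 / 2) = 0 by ring, Real.rpow_zero, one_mul]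

end CovarianceLimit

end Aggregated3N

end

open Aggregated3N in
theorem mainTheorem12
    (β φ₁ σ : ℝ) (hβ0 : 0 < β) (hβ1 : β < 1) (hβ : β ≠ 1 / 2) (hφ₁ : 0 < φ₁)
    (φ : ℝ → ℝ) (hφm : Measurable φ) (hφ0 : ∀ a ∈ Set.Ico (0 : ℝ) 1, 0 ≤ φ a)
    (hφint : ∫ a in Set.Ico (0 : ℝ) 1, φ a = 1)
    (hφbdd : ∃ K : ℝ, ∀ a ∈ Set.Ico (0 : ℝ) 1, φ a ≤ K)
    (hφasy : φ ~[𝓝[<] 1] fun a => φ₁ * (1 - a) ^ β)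
    {Ω : Type*} [MeasurableSpace Ω] (P : Measure Ω) [IsProbabilityMeasure P]
    (M : Set ((ℤ × ℤ) × ℝ) → Ω → ℝ)
    (hM : IsGaussianRandomMeasure P (controlMeasure σ φ) M) :
    (∃ X : ℤ × ℤ → Ω → ℝ, IsAggregatedField P σ φ M X) ∧
    ∀ X : ℤ × ℤ → Ω → ℝ, IsAggregatedField P σ φ M X →
      (∀ t s : ℝ, t ≠ 0 → s ≠ 0 →
        Tendsto (fun l : ℝ => l ^ (β + 1 / 2) * covFun P X ⌊l * t⌋ ⌊√l * s⌋) atTop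
          (𝓝 (constC3 β φ₁ σ * |s| ^ (-2 * β - 1) *
            lowerGamma (β + 1 / 2) (s ^ 2 / (4 * |t|))))) ∧
      (∀ s : ℝ, s ≠ 0 →
        Tendsto (fun l : ℝ => l ^ (β + 1 / 2) * covFun P X 0 ⌊√l * s⌋) atTop
          (𝓝 (constC3 β φ₁ σ * |s| ^ (-2 * β - 1) * Real.Gamma (β + 1 / 2)))) ∧
      (∀ t : ℝ, t ≠ 0 →
        Tendsto (fun l : ℝ => l ^ (β + 1 / 2) * covFun P X ⌊l * t⌋ 0) atTop
          (𝓝 (constC4 β φ₁ σ * |t| ^ (-β - 1 / 2)))) ∧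
      ((fun t : ℤ => covFun P X t 0) ~[cofinite]
        fun t : ℤ => constC4 β φ₁ σ * |(t : ℝ)| ^ (-β - 1 / 2)) := by
  obtain ⟨C, hφb⟩ := exists_le_mul_rpow hφ0 hφbdd hβ0 hφasy
  refine ⟨exists_isAggregatedField hM hφm hφ0 hβ0 hφb, fun X hX => ?_⟩
  have hfloor : ∀ s : ℝ, Tendsto (fun l : ℝ => (⌊√l * s⌋ : ℝ) / √l) atTop (𝓝 s) := fun s =>
    (tendsto_floor_mul_div s).comp Real.tendsto_sqrt_atTop
  have hhor : ∀ t : ℝ, t ≠ 0 →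
      Tendsto (fun l : ℝ => l ^ (β + 1 / 2) * covFun P X ⌊l * t⌋ 0) atTop
        (𝓝 (constC4 β φ₁ σ * |t| ^ (-β - 1 / 2))) := by
    intro t ht
    rw [← limit_const_horizontal φ₁ σ hβ0 ht]
    exact tendsto_covFun_of_ne_zero hM hφm hφ0 hβ0 hφ₁ hφb hφasy hX ht (S := fun _ => 0) (by simp)
  refine ⟨fun t s ht hs => ?_, fun s hs => ?_, hhor, ?_⟩
  · rw [← limit_const_generic φ₁ σ ht hs]
    exact tendsto_covFun_of_ne_zero hM hφm hφ0 hβ0 hφ₁ hφb hφasy hX ht (hfloor s)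
  · rw [← limit_const_vertical φ₁ σ hs]
    exact tendsto_covFun_zero hM hφm hφ0 hβ0 hφ₁ hφb hφasy hX hs (hfloor s)
  -- For σ = 0 the constant C₄ vanishes and the limit no longer determines an equivalence, but both
  -- sides are identically zero.
  · rcases eq_or_ne σ 0 with rfl | hσ
    · have h0 : (fun t : ℤ => covFun P X t 0) = fun _ => 0 := by
        ext t
        simp [covFun_eq hM hφm hφ0 hβ0 hφb hX]
      have h1 : (fun t : ℤ => constC4 β φ₁ 0 * |(t : ℝ)| ^ (-β - 1 / 2)) = fun _ => 0 := by
        ext t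
        simp [constC4, constC3]
      rw [h0, h1]
    · have hc : constC4 β φ₁ σ ≠ 0 := by
        have := Real.Gamma_pos_of_pos (show 0 < β + 1 by linarith)
        have := Real.pi_pos
        unfold constC4 constC3
        positivity
      have h := hhor 1 one_ne_zero
      rw [abs_one, Real.one_rpow, mul_one] at h
      exact isEquivalent_of_tendsto_rpow_mul hc
        (covFun_natAbs_zero hM hφm hφ0 hβ0 hφb hX) h
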